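/- Let $d\ge 1$ be an integer and write points of $\mathbb R^{2d}$ as $(x,v)$ with $x,v\in\mathbb R^d$. Let $\omega\subset\mathbb R^{2d}$ be an observability open set on the whole space $\mathbb R^{2d}$, i.e. an open set for which there exist $\delta>0$ and $r>0$ such that for every $y\in\mathbb R^{2d}$ there is $y'\in\omega$ with $B(y',r)\subset\omega$ and $|y-y'|\le\delta$, where $|\cdot|$ is the Euclidean norm and $B(y',r)$ the open Euclidean ball of radius $r$ centered at $y'$. Then there exists a constant $C=C(\omega,d)>0$ such that for all $T>0$, all $\alpha\in(0,1)$ and all $g_0\in L^2(\mathbb R^{2d};\mathbb C)$, the solution $g$ of the Kolmogorov equation $$(\partial_t+v\cdot\nabla_x-\Delta_v)g(t,x,v)=0\quad (t>0,\ x,v\in\mathbb R^d),\qquad g(0,\cdot,\cdot)=g_0,$$ satisfies $$\|g(T)\|_{L^2(\mathbb R^{2d})}\le e^{\frac{C}{\alpha}\left(1+\frac1{T^3}\right)}\,\|g(T)\|_{L^2(\omega)}^{1-\alpha}\,\|g_0\|_{L^2(\mathbb R^{2d})}^{\alpha}.$$ Here a solution is a function $g\in C([0,\infty);L^2(\mathbb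 R^{2d};\mathbb C))$ with $g(0)=g_0$ that satisfies the equation weakly: for every $\varphi\in C_c^\infty(\mathbb R^{2d};\mathbb C)$ and every $t\ge 0$, $$\int_{\mathbb R^{2d}} g(t)\varphi\,dx\,dv-\int_{\mathbb R^{2d}} g_0\varphi\,dx\,dv=\int_0^t\int_{\mathbb R^{2d}} g(s)\,\bigl(v\cdot\nabla_x\varphi+\Delta_v\varphi\bigr)\,dx\,dv\,ds .$$ -/

import Mathlib

open MeasureTheory

noncomputable section

/-- An observability open set on the whole space `ℝⁿ`: an open set `O` for which there are
`δ, r > 0` such that every point is at Euclidean distance at most `δ` from the centre of an open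
ball of radius `r` contained in `O`. -/
def IsObservabilityOpen {ι : Type*} [Fintype ι] (O : Set (EuclideanSpace ℝ ι)) : Prop :=
  IsOpen O ∧ ∃ δ > (0 : ℝ), ∃ r > (0 : ℝ), ∀ y : EuclideanSpace ℝ ι,
    ∃ y' ∈ O, Metric.ball y' r ⊆ O ∧ dist y y' ≤ δ

/-- The Euclidean space `ℝ^{2d}` of pairs `z = (x, v)`, with `x i = z (Sum.inl i)` (position) and
`v i = z (Sum.inr i)` (velocity). -/
abbrev Phase (d : ℕ) : Type := EuclideanSpace ℝ (Fin d ⊕ Fin d)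

/-- `∂φ/∂zⱼ`, for `j` one of the `2d` coordinates. -/
def partialDeriv {d : ℕ} (j : Fin d ⊕ Fin d) (φ : Phase d → ℂ) : Phase d → ℂ :=
  fun z => fderiv ℝ φ z (EuclideanSpace.single j (1 : ℝ))

/-- `v · ∇ₓ φ + Δᵥ φ`: the formal transpose of the operator `- v · ∇ₓ + Δᵥ`. -/
def kolmogorovTranspose {d : ℕ} (φ : Phase d → ℂ) : Phase d → ℂ := fun z =>
  (∑ i : Fin d, (z (Sum.inr i) : ℂ) * partialDeriv (Sum.inl i) φ z) +
    ∑ i : Fin d, partialDeriv (Sum.inr i) (partialDeriv (Sum.inr i) φ) z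

/-- `g ∈ C([0, ∞); L²(ℝ^{2d}))` is a weak solution of `(∂ₜ + v · ∇ₓ - Δᵥ) g = 0`, `g(0) = g₀`:
for all test functions `φ ∈ C_c^∞(ℝ^{2d})` and all `t ≥ 0`,
`∫ g(t) φ - ∫ g₀ φ = ∫₀ᵗ ∫ g(s) (v · ∇ₓ φ + Δᵥ φ) ds`.
(Values of `g` at negative times play no role.) -/
structure IsKolmogorovSolution {d : ℕ} (g₀ : Lp ℂ 2 (volume : Measure (Phase d)))
    (g : ℝ → Lp ℂ 2 (volume : Measure (Phase d))) : Prop where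
  continuousOn : ContinuousOn g (Set.Ici 0)
  initial : g 0 = g₀
  weak : ∀ φ : Phase d → ℂ, ContDiff ℝ (⊤ : ℕ∞) φ → HasCompactSupport φ → ∀ t : ℝ, 0 ≤ t →
    (∫ z, g t z * φ z) - (∫ z, g₀ z * φ z) =
      ∫ s in (0 : ℝ)..t, ∫ z, g s z * kolmogorovTranspose φ z

/-- `‖f‖_{L²(ω)}` for `f ∈ L²(ℝ^{2d})`. -/
def normOn {d : ℕ} (ω : Set (Phase d)) (f : Lp ℂ 2 (volume : Measure (Phase d))) : ℝ :=
  (eLpNorm f 2 (volume.restrict ω)).toReal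

end

/-! The proof combines a quantitative unique continuation inequality for `ω` with the Gaussian decay
in frequency of `g T`.

Unique continuation. If `z + h` lies well inside `ω`, then `f z` can be extrapolated from the values
`f (z + (1 - j/K) h)`, `j < n`; with `K = N n` and `N` a large fixed integer, all these points stay
in `ω`. In frequency, with `X = exp (-2πi⟨h, ζ⟩/K)`, this replaces `X ^ K = (1 + (X - 1)) ^ K` by
its binomial expansion truncated below degree `n`. By `exists_newton_coeff` the coefficients have
total size at most `3 ^ K = A ^ n`, while for any `b ≥ 1` the error is at most `b⁻ⁿ exp
(2πb|h||ζ|)`; take `b = A`. For every `z` a fixed proportion of the vectors `h` in a ball is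
admissible, so averaging over `h` yields `‖f‖ ≤ C (Aⁿ ‖f‖_ω + A⁻ⁿ ‖exp (R|ζ|) 𝓕 f‖)` for all `n ≥ 1`
(`IsObservabilityOpen.exists_spectral_inequality`).

Smoothing. In frequency the equation is a transport equation with damping, so `𝓕 (g T)` is `𝓕 g₀`
composed with a shear, times `exp (-4π² ∫₀ᵀ |η + sξ|² ds)` (`IsKolmogorovSolution.fourier_eq`). For
weak solutions this is proved by duality against explicit solutions of the dual transport equation.
The exponent controls `τ|ζ|²` with `τ = min T (T³)`, the cube coming from the directions `ξ` that
are damped only through transport.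

Conclusion. Young's inequality bounds `exp (R|ζ|)` by `exp (R²/(4ατ))` times the power `α` of `exp
(τ|ζ|²)`. Hence the weighted norm is at most `2 exp (R²/(4ατ)) (‖g₀‖/‖g T‖)^α ‖g T‖`. Choosing `n`
so that the error term is absorbed bounds `‖g T‖` by its norm on `ω` times a constant and `(‖g₀‖/‖g
T‖)^α`, which rearranges to the claim. -/

/-! ### Characters of a Euclidean space. -/

section PlaneWave

open scoped ContDiff

variable {E : Type*} [NormedAddCommGroup E] [InnerProductSpace ℝ E]

/-- The character `ζ ↦ exp (2πi⟨h, ζ⟩)`. -/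
noncomputable def planeWave (h ζ : E) : ℂ :=
  Complex.exp (((2 * Real.pi * inner ℝ h ζ : ℝ) : ℂ) * Complex.I)

theorem norm_planeWave (h ζ : E) : ‖planeWave h ζ‖ = 1 := Complex.norm_exp_ofReal_mul_I _

theorem contDiff_planeWave (h : E) : ContDiff ℝ ∞ (planeWave h) := by
  unfold planeWave
  refine Complex.contDiff_exp.comp ?_
  refine ContDiff.mul ?_ contDiff_const
  exact Complex.ofRealCLM.contDiff.comp
    ((contDiff_const (c := 2 * Real.pi)).mul (contDiff_const.inner ℝ contDiff_id))

end PlaneWave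

/-! ### Fourier transform and translations on `L²`. -/

section FourierTools

open SchwartzMap FourierTransform
open scoped ContDiff

variable {E : Type*} [NormedAddCommGroup E] [InnerProductSpace ℝ E] [FiniteDimensional ℝ E]
  [MeasurableSpace E] [BorelSpace E]

/-- The form is bilinear, without conjugation, like the weak formulation of the equation, which
therefore passes directly to the frequency side. -/
theorem integral_fourier_mul_schwartz (f : Lp ℂ 2 (volume : Measure E)) (b : 𝓢(E, ℂ)) :
    ∫ z, (𝓕 f) z * b z = ∫ z, f z * (𝓕 b) z := by
  have h := congrArg (fun T => T b) (Lp.fourier_toTemperedDistribution_eq f)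
  simp only [TemperedDistribution.fourier_apply, Lp.toTemperedDistribution_apply,
    smul_eq_mul] at h
  simp_rw [mul_comm _ (b _), mul_comm _ ((𝓕 b) _)]
  exact h.symm

/-- The translate `z ↦ f (z + h)` of an `L²` function. -/
noncomputable def translateLp (h : E) (f : Lp ℂ 2 (volume : Measure E)) :
    Lp ℂ 2 (volume : Measure E) :=
  Lp.compMeasurePreserving (· + h) (measurePreserving_add_right volume h) f

theorem translateLp_coeFn (h : E) (f : Lp ℂ 2 (volume : Measure E)) :
    translateLp h f =ᵐ[volume] fun z => f (z + h) :=
  Lp.coeFn_compMeasurePreserving f (measurePreserving_add_right volume h)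

theorem fourier_planeWave_mul (h : E) (b c : 𝓢(E, ℂ)) (hc : ∀ ζ, c ζ = planeWave h ζ * b ζ)
    (z : E) : (𝓕 c) z = (𝓕 b) (z - h) := by
  rw [fourier_coe, fourier_coe, Real.fourier_eq', Real.fourier_eq']
  refine integral_congr_ae (Filter.Eventually.of_forall fun ζ => ?_)
  simp only [hc, planeWave, smul_eq_mul]
  rw [← mul_assoc, ← Complex.exp_add]
  congr 2
  rw [inner_sub_right, real_inner_comm h ζ]
  push_cast
  ring

theorem locallyIntegrable_Lp (f : Lp ℂ 2 (volume : Measure E)) :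
    LocallyIntegrable f (volume : Measure E) :=
  (Lp.memLp f).locallyIntegrable (by norm_num)

theorem integrable_Lp_mul_schwartz (f : Lp ℂ 2 (volume : Measure E)) (b : 𝓢(E, ℂ)) :
    Integrable fun z => f z * b z :=
  MemLp.integrable_mul (Lp.memLp f) (b.memLp 2)

/-- Two locally integrable functions that agree against all complex test functions agree a.e. -/
theorem ae_eq_of_integral_mul_schwartz_eq {f f' : E → ℂ} (hf : LocallyIntegrable f)
    (hf' : LocallyIntegrable f') (h : ∀ b : 𝓢(E, ℂ), HasCompactSupport b →
      ∫ z, f z * b z = ∫ z, f' z * b z) : f =ᵐ[volume] f' := by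
  refine ae_eq_of_integral_contDiff_smul_eq hf hf' fun g hg hgs => ?_
  have h1 : HasCompactSupport fun z => (g z : ℂ) := hgs.comp_left Complex.ofReal_zero
  have h2 : ContDiff ℝ ∞ fun z => (g z : ℂ) := Complex.ofRealCLM.contDiff.comp hg
  have := h (h1.toSchwartzMap h2) h1
  simpa [mul_comm] using this

/-- By duality: a compactly supported test function times a character is again one, and its Fourier
transform is a translate, which a change of variables moves onto `f`. -/
theorem fourier_translateLp (h : E) (f : Lp ℂ 2 (volume : Measure E)) :
    (𝓕 (translateLp h f) : Lp ℂ 2 (volume : Measure E)) =ᵐ[volume] fun ζ => planeWave h ζ * (𝓕 f) ζ := by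
  have hcont := (contDiff_planeWave h).continuous
  refine ae_eq_of_integral_mul_schwartz_eq (locallyIntegrable_Lp _) ?_ fun b hb => ?_
  · refine MemLp.locallyIntegrable (p := 2) ?_ (by norm_num)
    refine (Lp.memLp (𝓕 f)).of_le (hcont.aestronglyMeasurable.mul (Lp.aestronglyMeasurable _)) ?_
    exact Filter.Eventually.of_forall fun ζ => by simp [norm_planeWave]
  · have h1 : HasCompactSupport fun ζ => planeWave h ζ * b ζ := hb.mul_left
    set c := h1.toSchwartzMap ((contDiff_planeWave h).mul (b.smooth ⊤)) with hc
    have hc' : ∀ ζ, c ζ = planeWave h ζ * b ζ := fun ζ => rfl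
    calc ∫ z, (𝓕 (translateLp h f)) z * b z = ∫ z, translateLp h f z * (𝓕 b) z :=
          integral_fourier_mul_schwartz _ _
      _ = ∫ z, f (z + h) * (𝓕 b) z := by
          refine integral_congr_ae ?_
          filter_upwards [translateLp_coeFn h f] with z hz
          rw [hz]
      _ = ∫ z, f (z + h) * (𝓕 c) (z + h) := by
          simp_rw [fourier_planeWave_mul h b c hc', add_sub_cancel_right]
      _ = ∫ z, f z * (𝓕 c) z := integral_add_right_eq_self (fun z => f z * (𝓕 c) z) h
      _ = ∫ z, (𝓕 f) z * c z := (integral_fourier_mul_schwartz _ _).symm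
      _ = _ := by
          simp_rw [hc']
          congr 1 with z
          ring

end FourierTools

/-! ### Newton extrapolation and measure-theoretic preliminaries. -/

/-- Truncated Newton extrapolation: `X ^ K` is approximated by a polynomial of degree `< n`. -/
theorem exists_newton_coeff (K n : ℕ) : ∃ c : ℕ → ℂ, ∑ j ∈ Finset.range n, ‖c j‖ ≤ 3 ^ K ∧
    ∀ b : ℝ, 1 ≤ b → ∀ X : ℂ,
      b ^ n * ‖X ^ K - ∑ j ∈ Finset.range n, c j * X ^ j‖ ≤ (1 + b * ‖X - 1‖) ^ K := by
  classical
  -- `a m j` is the coefficient of `X ^ j` in `K.choose m * (X - 1) ^ m`; only the terms with `m <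
  -- n` are kept.
  let a : ℕ → ℕ → ℂ := fun m j => (K.choose m : ℂ) * ((-1) ^ (m - j) * (m.choose j : ℂ))
  let s : Finset ℕ := (Finset.range (K + 1)).filter (· < n)
  have hmn : ∀ m ∈ s, ∀ F : ℕ → ℂ, (∀ j, m < j → F j = 0) →
      ∑ j ∈ Finset.range n, F j = ∑ j ∈ Finset.range (m + 1), F j := by
    intro m hm F hF
    have hm' : m < n := (Finset.mem_filter.1 hm).2
    refine (Finset.sum_subset (Finset.range_subset_range.2 hm') fun j _ hj => hF j ?_).symm
    simpa [Nat.lt_succ_iff] using hj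
  have ha : ∀ m j, m < j → a m j = 0 := fun m j h => by simp [a, Nat.choose_eq_zero_of_lt h]
  refine ⟨fun j => ∑ m ∈ s, a m j, ?_, fun b hb X => ?_⟩
  · calc ∑ j ∈ Finset.range n, ‖∑ m ∈ s, a m j‖
        ≤ ∑ j ∈ Finset.range n, ∑ m ∈ s, ‖a m j‖ := Finset.sum_le_sum fun j _ => norm_sum_le _ _
      _ = ∑ m ∈ s, ∑ j ∈ Finset.range n, ‖a m j‖ := Finset.sum_comm
      _ = ∑ m ∈ s, (K.choose m : ℝ) * 2 ^ m := by
          refine Finset.sum_congr rfl fun m hm => ?_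
          have h1 := hmn m hm (fun j => (‖a m j‖ : ℂ)) (fun j h => by simp [ha m j h])
          have h2 : ∑ j ∈ Finset.range n, ‖a m j‖ = ∑ j ∈ Finset.range (m + 1), ‖a m j‖ := by
            exact_mod_cast h1
          rw [h2]
          have h3 : ∀ j, ‖a m j‖ = (K.choose m : ℝ) * (m.choose j : ℝ) := fun j => by simp [a]
          simp_rw [h3, ← Finset.mul_sum]
          congr 1
          exact_mod_cast Nat.sum_range_choose m
      _ ≤ ∑ m ∈ Finset.range (K + 1), (K.choose m : ℝ) * 2 ^ m :=
          Finset.sum_le_sum_of_subset_of_nonneg (Finset.filter_subset _ _)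
            fun _ _ _ => by positivity
      _ = 3 ^ K := by
          have := add_pow (2 : ℝ) 1 K
          norm_num at this
          rw [this]
          exact Finset.sum_congr rfl fun m _ => mul_comm _ _
  · have hin : ∑ j ∈ Finset.range n, (∑ m ∈ s, a m j) * X ^ j
        = ∑ m ∈ s, (X - 1) ^ m * (K.choose m : ℂ) := by
      simp_rw [Finset.sum_mul]
      rw [Finset.sum_comm]
      refine Finset.sum_congr rfl fun m hm => ?_
      rw [hmn m hm (fun j => a m j * X ^ j) (fun j h => by simp [ha m j h]), sub_eq_add_neg,
        add_pow, Finset.sum_mul]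
      refine Finset.sum_congr rfl fun j _ => ?_
      simp only [a]
      ring
    have hK : X ^ K = ∑ m ∈ Finset.range (K + 1), (X - 1) ^ m * (K.choose m : ℂ) := by
      have := add_pow (X - 1) 1 K
      simpa using this
    have hdiff : X ^ K - ∑ m ∈ s, (X - 1) ^ m * (K.choose m : ℂ)
        = ∑ m ∈ (Finset.range (K + 1)).filter (¬ · < n), (X - 1) ^ m * (K.choose m : ℂ) := by
      rw [hK, ← Finset.sum_filter_add_sum_filter_not _ (· < n)]
      simp [s]
    rw [hin, hdiff]
    have hb0 : 0 ≤ b := by linarith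
    -- The remainder has only terms with `m ≥ n`, where `b ^ n ≤ b ^ m`; the factor is absorbed into
    -- `(b‖X - 1‖) ^ m` and the sum is completed.
    calc b ^ n * ‖∑ m ∈ (Finset.range (K + 1)).filter (¬ · < n), (X - 1) ^ m * (K.choose m : ℂ)‖
        ≤ b ^ n * ∑ m ∈ (Finset.range (K + 1)).filter (¬ · < n),
            ‖X - 1‖ ^ m * (K.choose m : ℝ) := by
          gcongr
          refine (norm_sum_le _ _).trans (le_of_eq ?_)
          simp
      _ ≤ ∑ m ∈ (Finset.range (K + 1)).filter (¬ · < n),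
            (b * ‖X - 1‖) ^ m * (K.choose m : ℝ) := by
          rw [Finset.mul_sum]
          refine Finset.sum_le_sum fun m hm => ?_
          have hm' : n ≤ m := by simpa using (Finset.mem_filter.1 hm).2
          rw [mul_pow, ← mul_assoc]
          gcongr
      _ ≤ ∑ m ∈ Finset.range (K + 1), (b * ‖X - 1‖) ^ m * (K.choose m : ℝ) :=
          Finset.sum_le_sum_of_subset_of_nonneg (Finset.filter_subset _ _)
            fun _ _ _ => by positivity
      _ = (1 + b * ‖X - 1‖) ^ K := by
          rw [add_comm (1 : ℝ), add_pow]
          simp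

/-- A ball lies in `ω` exactly when its centre is at distance at least `r` from every point outside
`ω`. This makes the set of admissible centres measurable. -/
theorem isClosed_setOf_ball_subset {X : Type*} [PseudoMetricSpace X] (ω : Set X) (r : ℝ) :
    IsClosed {u : X | Metric.ball u r ⊆ ω} := by
  have : {u : X | Metric.ball u r ⊆ ω} = ⋂ p ∈ ωᶜ, {u : X | r ≤ dist p u} := by
    ext u
    simp only [Set.mem_ofPred_eq, Set.mem_iInter, Set.mem_compl_iff]
    constructor
    · intro h p hp
      by_contra hlt
      exact hp (h (Metric.mem_ball.2 (not_le.1 hlt)))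
    · intro h p hp
      by_contra hpω
      exact absurd (h p hpω) (not_le.2 (Metric.mem_ball.1 hp))
  rw [this]
  exact isClosed_biInter fun p _ => isClosed_le continuous_const (by fun_prop)

theorem eLpNorm_two_sq {α F : Type*} [MeasurableSpace α] [NormedAddCommGroup F] {μ : Measure α}
    (f : α → F) : eLpNorm f 2 μ ^ 2 = ∫⁻ z, ‖f z‖ₑ ^ 2 ∂μ := by
  have := eLpNorm_nnreal_pow_eq_lintegral (f := f) (μ := μ) (p := 2) (by norm_num)
  simpa using this

/-! ### Extrapolation from translates and averaging over the shift. -/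

section SpectralInequality

open FourierTransform
open scoped ENNReal

variable {E : Type*} [NormedAddCommGroup E] [InnerProductSpace ℝ E] [FiniteDimensional ℝ E]
  [MeasurableSpace E] [BorelSpace E]

/-- The combination `f - ∑ⱼ cⱼ f (· + (1 - j / K) h)` of translates of `f`. -/
noncomputable def extrapolationError (K n : ℕ) (c : ℕ → ℂ) (h : E)
    (f : Lp ℂ 2 (volume : Measure E)) : Lp ℂ 2 (volume : Measure E) :=
  f - ∑ j ∈ Finset.range n, c j • translateLp ((1 - (j : ℝ) / K) • h) f

theorem fourier_extrapolationError (K n : ℕ) (c : ℕ → ℂ) (h : E)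
    (f : Lp ℂ 2 (volume : Measure E)) :
    (𝓕 (extrapolationError K n c h f) : Lp ℂ 2 (volume : Measure E)) =ᵐ[volume] fun ζ =>
      (1 - ∑ j ∈ Finset.range n, c j * planeWave ((1 - (j : ℝ) / K) • h) ζ) *
        (𝓕 f : Lp ℂ 2 (volume : Measure E)) ζ := by
  have e : (𝓕 (extrapolationError K n c h f) : Lp ℂ 2 (volume : Measure E)) =
      𝓕 f - ∑ j ∈ Finset.range n, c j •
        (𝓕 (translateLp ((1 - (j : ℝ) / K) • h) f) : Lp ℂ 2 (volume : Measure E)) := by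
    change Lp.fourierTransformₗᵢ E ℂ _ = Lp.fourierTransformₗᵢ E ℂ _ -
      ∑ j ∈ Finset.range n, c j • Lp.fourierTransformₗᵢ E ℂ _
    simp only [extrapolationError, map_sub, map_sum, map_smul]
  rw [e]
  have h1 : ∀ j : ℕ, (c j • (𝓕 (translateLp ((1 - (j : ℝ) / K) • h) f) :
      Lp ℂ 2 (volume : Measure E)) : Lp ℂ 2 (volume : Measure E)) =ᵐ[volume]
      fun ζ => c j * (planeWave ((1 - (j : ℝ) / K) • h) ζ *
        (𝓕 f : Lp ℂ 2 (volume : Measure E)) ζ) := by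
    intro j
    filter_upwards [Lp.coeFn_smul (c j) (𝓕 (translateLp ((1 - (j : ℝ) / K) • h) f) :
      Lp ℂ 2 (volume : Measure E)), fourier_translateLp ((1 - (j : ℝ) / K) • h) f] with ζ a b
    rw [a, Pi.smul_apply, b, smul_eq_mul]
  filter_upwards [Lp.coeFn_sub (𝓕 f : Lp ℂ 2 (volume : Measure E))
    (∑ j ∈ Finset.range n, c j •
        (𝓕 (translateLp ((1 - (j : ℝ) / K) • h) f) : Lp ℂ 2 (volume : Measure E))),
    Lp.coeFn_fun_finsetSum (Finset.range n) (fun j => c j •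
        (𝓕 (translateLp ((1 - (j : ℝ) / K) • h) f) : Lp ℂ 2 (volume : Measure E))),
    ae_all_iff.2 h1] with ζ a b d
  rw [a, Pi.sub_apply, b, sub_mul, one_mul, Finset.sum_mul]
  congr 1
  exact Finset.sum_congr rfl fun j _ => by rw [d j, mul_assoc]

/-- Up to a unimodular factor the multiplier is `X ^ K - ∑ cⱼ X ^ j` with `X` on the unit circle.
Since `‖X - 1‖ ≤ 2πρ‖ζ‖/K`, the bound `(1 + x) ^ K ≤ exp (K x)` gives an estimate in which `K`
cancels. -/
theorem norm_one_sub_sum_planeWave_le {E : Type*} [NormedAddCommGroup E] [InnerProductSpace ℝ E]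
    {K n : ℕ} (hK : 0 < K) {c : ℕ → ℂ} {b : ℝ} (hb : 1 ≤ b)
    (hc : ∀ X : ℂ,
      b ^ n * ‖X ^ K - ∑ j ∈ Finset.range n, c j * X ^ j‖ ≤ (1 + b * ‖X - 1‖) ^ K)
    {ρ : ℝ} {h : E} (hh : ‖h‖ ≤ ρ) (ζ : E) :
    ‖1 - ∑ j ∈ Finset.range n, c j * planeWave ((1 - (j : ℝ) / K) • h) ζ‖ ≤
      (b ^ n)⁻¹ * Real.exp (2 * Real.pi * b * ρ * ‖ζ‖) := by
  set θ : ℝ := -(2 * Real.pi * inner ℝ h ζ) / K with hθ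
  set X : ℂ := Complex.exp ((θ : ℂ) * Complex.I) with hX
  have hK' : (K : ℝ) ≠ 0 := by positivity
  have hb0 : 0 < b := by linarith
  have hpw : ∀ j : ℕ, X ^ K * planeWave ((1 - (j : ℝ) / K) • h) ζ = X ^ j := by
    intro j
    rw [hX, ← Complex.exp_nat_mul, ← Complex.exp_nat_mul, planeWave, ← Complex.exp_add]
    congr 1
    rw [real_inner_smul_left, hθ]
    push_cast
    have : (K : ℂ) ≠ 0 := by exact_mod_cast hK.ne'
    field_simp
    ring
  have hXn : ‖X‖ = 1 := Complex.norm_exp_ofReal_mul_I _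
  have e : ‖1 - ∑ j ∈ Finset.range n, c j * planeWave ((1 - (j : ℝ) / K) • h) ζ‖ =
      ‖X ^ K - ∑ j ∈ Finset.range n, c j * X ^ j‖ := by
    calc ‖1 - ∑ j ∈ Finset.range n, c j * planeWave ((1 - (j : ℝ) / K) • h) ζ‖
        = ‖X ^ K‖ * ‖1 - ∑ j ∈ Finset.range n, c j * planeWave ((1 - (j : ℝ) / K) • h) ζ‖ := by
          rw [norm_pow, hXn, one_pow, one_mul]
      _ = _ := by
          rw [← norm_mul, mul_sub, mul_one, Finset.mul_sum]
          simp_rw [mul_left_comm (X ^ K), hpw]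
  have hX1 : ‖X - 1‖ ≤ 2 * Real.pi * ρ * ‖ζ‖ / K := by
    have h1 : ‖X - 1‖ ≤ ‖θ‖ := by
      have := Real.norm_exp_I_mul_ofReal_sub_one_le (x := θ)
      rwa [mul_comm] at this
    refine h1.trans ?_
    rw [hθ, norm_div, norm_neg, norm_mul, Real.norm_of_nonneg (by positivity : 0 ≤ 2 * Real.pi),
      Real.norm_natCast]
    have h2 : ‖inner ℝ h ζ‖ ≤ ρ * ‖ζ‖ :=
      (norm_inner_le_norm h ζ).trans (mul_le_mul_of_nonneg_right hh (norm_nonneg _))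
    rw [mul_assoc (2 * Real.pi)]
    gcongr
  rw [e, inv_mul_eq_div, le_div_iff₀ (by positivity), mul_comm]
  refine (hc X).trans ?_
  calc (1 + b * ‖X - 1‖) ^ K ≤ (Real.exp (b * ‖X - 1‖)) ^ K := by
        gcongr
        rw [add_comm]
        exact Real.add_one_le_exp _
    _ = Real.exp (K * (b * ‖X - 1‖)) := by rw [← Real.exp_nat_mul]
    _ ≤ _ := by
        rw [Real.exp_le_exp]
        calc K * (b * ‖X - 1‖) ≤ K * (b * (2 * Real.pi * ρ * ‖ζ‖ / K)) := by gcongr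
          _ = _ := by field_simp

theorem eLpNorm_extrapolationError_le {K n : ℕ} (hK : 0 < K) {c : ℕ → ℂ} {b : ℝ} (hb : 1 ≤ b)
    (hc : ∀ X : ℂ,
      b ^ n * ‖X ^ K - ∑ j ∈ Finset.range n, c j * X ^ j‖ ≤ (1 + b * ‖X - 1‖) ^ K)
    {ρ : ℝ} {h : E} (hh : ‖h‖ ≤ ρ) (f : Lp ℂ 2 (volume : Measure E)) :
    eLpNorm (extrapolationError K n c h f) 2 volume ≤ ENNReal.ofReal (b ^ n)⁻¹ *
      eLpNorm (fun ζ => Real.exp (2 * Real.pi * b * ρ * ‖ζ‖) •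
        (𝓕 f : Lp ℂ 2 (volume : Measure E)) ζ) 2 volume := by
  have e : eLpNorm (extrapolationError K n c h f) 2 volume = eLpNorm
      (𝓕 (extrapolationError K n c h f) : Lp ℂ 2 (volume : Measure E)) 2 volume := by
    rw [← Lp.enorm_def, ← Lp.enorm_def, ← ofReal_norm, ← ofReal_norm, Lp.norm_fourier_eq]
  rw [e]
  refine eLpNorm_le_mul_eLpNorm_of_ae_le_mul ?_ 2
  filter_upwards [fourier_extrapolationError K n c h f] with ζ hζ
  rw [hζ, norm_mul, norm_smul, Real.norm_of_nonneg (Real.exp_nonneg _), ← mul_assoc]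
  gcongr
  exact norm_one_sub_sum_planeWave_le hK hb hc hh ζ

theorem eLpNorm_comp_add_restrict_le {U ω : Set E} (hω : MeasurableSet ω) {k : E}
    (hU : ∀ z ∈ U, z + k ∈ ω) (f : Lp ℂ 2 (volume : Measure E)) :
    eLpNorm (fun z => f (z + k)) 2 (volume.restrict U) ≤ eLpNorm f 2 (volume.restrict ω) := by
  have h1 := (measurePreserving_add_right (volume : Measure E) k).restrict_preimage hω
  have h2 := eLpNorm_comp_measurePreserving (p := 2)
    ((Lp.aestronglyMeasurable f).mono_measure Measure.restrict_le_self) h1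
  rw [← h2]
  exact eLpNorm_mono_measure _ (Measure.restrict_mono hU le_rfl)

theorem eLpNorm_restrict_le_of_translates {U ω : Set E} (hω : MeasurableSet ω) {K n : ℕ} {h : E}
    (hU : ∀ z ∈ U, ∀ j < n, z + (1 - (j : ℝ) / K) • h ∈ ω) (c : ℕ → ℂ)
    (f : Lp ℂ 2 (volume : Measure E)) :
    eLpNorm f 2 (volume.restrict U) ≤ eLpNorm (extrapolationError K n c h f) 2 volume +
      ENNReal.ofReal (∑ j ∈ Finset.range n, ‖c j‖) * eLpNorm f 2 (volume.restrict ω) := by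
  have hf : ∀ k : E, AEStronglyMeasurable (fun z => f (z + k)) (volume.restrict U) := fun k =>
    (((Lp.stronglyMeasurable f).comp_measurable (measurable_add_const k))).aestronglyMeasurable
  have e : f =ᵐ[volume.restrict U] (extrapolationError K n c h f : E → ℂ) +
      ∑ j ∈ Finset.range n, c j • fun z => f (z + (1 - (j : ℝ) / K) • h) := by
    refine ae_restrict_of_ae ?_
    have h1 : ∀ j : ℕ, (c j • translateLp ((1 - (j : ℝ) / K) • h) f :
        Lp ℂ 2 (volume : Measure E)) =ᵐ[volume] fun z => c j * f (z + (1 - (j : ℝ) / K) • h) := by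
      intro j
      filter_upwards [Lp.coeFn_smul (c j) (translateLp ((1 - (j : ℝ) / K) • h) f),
        translateLp_coeFn ((1 - (j : ℝ) / K) • h) f] with ζ a b
      rw [a, Pi.smul_apply, b, smul_eq_mul]
    filter_upwards [Lp.coeFn_sub f
      (∑ j ∈ Finset.range n, c j • translateLp ((1 - (j : ℝ) / K) • h) f),
      Lp.coeFn_fun_finsetSum (Finset.range n)
        (fun j => c j • translateLp ((1 - (j : ℝ) / K) • h) f), ae_all_iff.2 h1] with z a b d
    rw [Pi.add_apply, extrapolationError, a, Pi.sub_apply, b, Finset.sum_apply]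
    simp [d]
  rw [eLpNorm_congr_ae e]
  refine (eLpNorm_add_le ((Lp.aestronglyMeasurable _).mono_measure Measure.restrict_le_self)
    (Finset.aestronglyMeasurable_sum _ fun j _ => (hf _).const_smul _) (by norm_num)).trans ?_
  refine add_le_add (eLpNorm_mono_measure _ Measure.restrict_le_self) ?_
  refine (eLpNorm_sum_le (fun j _ => (hf _).const_smul _) (by norm_num)).trans ?_
  rw [ENNReal.ofReal_sum_of_nonneg fun _ _ => norm_nonneg _, Finset.sum_mul]
  refine Finset.sum_le_sum fun j hj => ?_
  rw [eLpNorm_const_smul, ofReal_norm]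
  gcongr
  exact eLpNorm_comp_add_restrict_le hω (fun z hz => hU z hz j (Finset.mem_range.1 hj)) f

/-- Averaging over translations: a bound for `f` on every small translate of a set `W` that
meets every ball in a set of measure at least `v` bounds `f` globally. -/
theorem mul_eLpNorm_sq_le_of_translates {W : Set E} (hW : MeasurableSet W) {ρ : ℝ} {v B : ℝ≥0∞}
    (hv : ∀ z : E, v ≤ volume (Metric.ball (0 : E) ρ ∩ {h | z + h ∈ W}))
    (f : Lp ℂ 2 (volume : Measure E))
    (hB : ∀ h ∈ Metric.ball (0 : E) ρ, eLpNorm f 2 (volume.restrict {z | z + h ∈ W}) ≤ B) :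
    v * eLpNorm f 2 volume ^ 2 ≤ volume (Metric.ball (0 : E) ρ) * B ^ 2 := by
  have hfm : Measurable fun z => ‖f z‖ₑ ^ 2 := (Lp.stronglyMeasurable f).measurable.enorm.pow_const 2
  have hW1 : ∀ h : E, MeasurableSet {z | z + h ∈ W} := fun h => measurable_add_const h hW
  have hW2 : ∀ z : E, MeasurableSet {h | z + h ∈ W} := fun z => measurable_const_add z hW
  -- Tonelli for `|f z|² 1_W (z + h)`: integrating in `z` first gives the upper bound through `B`,
  -- integrating in `h` first the lower bound through `v`.
  let F : E → E → ℝ≥0∞ := fun z h => W.indicator (fun _ => ‖f z‖ₑ ^ 2) (z + h)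
  have hF : Measurable (Function.uncurry F) := by
    have : Function.uncurry F = ({p : E × E | p.1 + p.2 ∈ W}).indicator
        fun p => ‖f p.1‖ₑ ^ 2 := by
      ext p
      simp [F, Function.uncurry, Set.indicator]
    rw [this]
    exact (hfm.comp measurable_fst).indicator (measurable_add hW)
  have h1 : ∫⁻ h in Metric.ball (0 : E) ρ, ∫⁻ z, F z h ≤ volume (Metric.ball (0 : E) ρ) * B ^ 2 := by
    rw [mul_comm, ← setLIntegral_const]
    refine setLIntegral_mono measurable_const fun h hh => ?_
    have : ∫⁻ z, F z h = ∫⁻ z in {z | z + h ∈ W}, ‖f z‖ₑ ^ 2 := by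
      rw [← lintegral_indicator (hW1 h)]
      rfl
    rw [this, ← eLpNorm_two_sq]
    gcongr
    exact hB h hh
  refine le_trans ?_ h1
  rw [lintegral_lintegral_swap (f := fun h z => F z h)
    (hF.comp measurable_swap).aemeasurable, eLpNorm_two_sq, ← lintegral_const_mul _ hfm]
  refine lintegral_mono fun z => ?_
  have : ∫⁻ h in Metric.ball (0 : E) ρ, F z h =
      ‖f z‖ₑ ^ 2 * volume (Metric.ball (0 : E) ρ ∩ {h | z + h ∈ W}) := by
    have e : (fun h => F z h) = ({h | z + h ∈ W}).indicator fun _ => ‖f z‖ₑ ^ 2 := by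
      ext h
      simp [F, Set.indicator]
    rw [e, lintegral_indicator_const (hW2 z), Measure.restrict_apply (hW2 z), Set.inter_comm]
  rw [this, mul_comm]
  gcongr
  exact hv z

end SpectralInequality

/-! ### The spectral inequality on observability open sets. -/

section ObservabilitySets

open FourierTransform
open scoped ENNReal

variable {ι : Type*} [Fintype ι]

/-- A quantitative unique continuation inequality: up to an error that decays geometrically in `n`
and is controlled by an exponential weight on the Fourier side, the mass of `f` is at most `A ^ n`
times its mass on an observability open set. -/
theorem IsObservabilityOpen.exists_spectral_inequality {ω : Set (EuclideanSpace ℝ ι)}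
    (hω : IsObservabilityOpen ω) : ∃ C A R : ℝ, 0 < C ∧ 1 < A ∧ 0 < R ∧
    ∀ (f : Lp ℂ 2 (volume : Measure (EuclideanSpace ℝ ι))) (n : ℕ), 0 < n →
      eLpNorm f 2 volume ≤ ENNReal.ofReal C *
        (ENNReal.ofReal (A ^ n) * eLpNorm f 2 (volume.restrict ω) + ENNReal.ofReal (A ^ n)⁻¹ *
          eLpNorm (fun ζ => Real.exp (R * ‖ζ‖) •
            (𝓕 f : Lp ℂ 2 (volume : Measure (EuclideanSpace ℝ ι))) ζ) 2 volume) := by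
  obtain ⟨hopen, δ, hδ, r, hr, hball⟩ := hω
  -- With this radius, the ball of radius `r / 2` about `y - z` lies in the ball of radius `ρ` about
  -- `0` whenever `|z - y| ≤ δ`.
  set ρ : ℝ := δ + r / 2 with hρdef
  have hρ : 0 < ρ := by positivity
  -- The sample points are within `‖h‖ / N < r / 2` of `z + h`, because `j < n` and `K = N n`.
  obtain ⟨N, hN⟩ := exists_nat_gt (2 * ρ / r)
  have hN0 : 0 < N := by
    have : 0 < 2 * ρ / r := by positivity
    exact_mod_cast this.trans hN
  -- The coefficient bound is `3 ^ (N n) = A ^ n`. The same `A` serves below as the free parameter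
  -- `b`, so the error decays at the rate `A⁻ⁿ`.
  set A : ℝ := 3 ^ N with hA
  have hA1 : 1 < A := one_lt_pow₀ (by norm_num) hN0.ne'
  set v : ℝ≥0∞ := volume (Metric.ball (0 : EuclideanSpace ℝ ι) (r / 2)) with hv
  set V : ℝ≥0∞ := volume (Metric.ball (0 : EuclideanSpace ℝ ι) ρ) with hV
  have hv0 : v ≠ 0 := (Metric.measure_ball_pos volume 0 (half_pos hr)).ne'
  have hvt : v ≠ ⊤ := measure_ball_lt_top.ne
  have hV0 : V ≠ 0 := (Metric.measure_ball_pos volume 0 hρ).ne'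
  have hVt : V ≠ ⊤ := measure_ball_lt_top.ne
  set C : ℝ := Real.sqrt (V.toReal / v.toReal) with hC
  have hC0 : 0 < C :=
    Real.sqrt_pos.2 (div_pos (ENNReal.toReal_pos hV0 hVt) (ENNReal.toReal_pos hv0 hvt))
  have hCsq : ENNReal.ofReal C ^ 2 = V / v := by
    rw [← ENNReal.ofReal_pow hC0.le, hC, Real.sq_sqrt (by positivity), ← ENNReal.toReal_div,
      ENNReal.ofReal_toReal (ENNReal.div_ne_top hVt hv0)]
  set W : Set (EuclideanSpace ℝ ι) := {u | Metric.ball u (r / 2) ⊆ ω} with hW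
  have hWm : MeasurableSet W := (isClosed_setOf_ball_subset ω (r / 2)).measurableSet
  refine ⟨C, A, 2 * Real.pi * A * ρ, hC0, hA1, by positivity, fun f n hn => ?_⟩
  obtain ⟨c, hc1, hc2⟩ := exists_newton_coeff (N * n) n
  have hK : 0 < N * n := by positivity
  set B : ℝ≥0∞ := ENNReal.ofReal (A ^ n) * eLpNorm f 2 (volume.restrict ω) +
    ENNReal.ofReal (A ^ n)⁻¹ * eLpNorm (fun ζ => Real.exp (2 * Real.pi * A * ρ * ‖ζ‖) •
      (𝓕 f : Lp ℂ 2 (volume : Measure (EuclideanSpace ℝ ι))) ζ) 2 volume with hBdef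
  have key : v * eLpNorm f 2 volume ^ 2 ≤ V * B ^ 2 := by
    refine mul_eLpNorm_sq_le_of_translates hWm (fun z => ?_) f (fun h hh => ?_)
    · obtain ⟨y, -, hyω, hzy⟩ := hball z
      rw [hv, ← Measure.addHaar_ball_center volume (y - z) (r / 2)]
      refine measure_mono fun h hh => ⟨?_, fun p hp => hyω ?_⟩
      · rw [mem_ball_zero_iff]
        have h1 : ‖h - (y - z)‖ < r / 2 := by simpa [dist_eq_norm] using hh
        have h2 : ‖y - z‖ ≤ δ := by rwa [← dist_eq_norm, dist_comm]
        have h3 : ‖h‖ ≤ ‖h - (y - z)‖ + ‖y - z‖ := by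
          simpa using norm_add_le (h - (y - z)) (y - z)
        rw [hρdef]
        linarith
      · have h1 : ‖h - (y - z)‖ < r / 2 := by simpa [dist_eq_norm] using hh
        have h2 : ‖p - (z + h)‖ < r / 2 := by simpa [dist_eq_norm] using hp
        have h3 : ‖p - y‖ ≤ ‖p - (z + h)‖ + ‖h - (y - z)‖ := by
          have := norm_add_le (p - (z + h)) (h - (y - z))
          rwa [show p - (z + h) + (h - (y - z)) = p - y by abel] at this
        rw [Metric.mem_ball, dist_eq_norm]
        linarith
    · have hh' : ‖h‖ < ρ := mem_ball_zero_iff.1 hh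
      refine (eLpNorm_restrict_le_of_translates (K := N * n) (n := n) (h := h)
        hopen.measurableSet (fun z hz j hj => ?_) c f).trans ?_
      · refine hz ?_
        rw [Metric.mem_ball, dist_eq_norm]
        have e : z + (1 - (j : ℝ) / (N * n : ℕ)) • h - (z + h) = -((j : ℝ) / (N * n : ℕ)) • h := by
          module
        rw [e, norm_smul, norm_neg, Real.norm_of_nonneg (by positivity)]
        have hjN : (j : ℝ) / (N * n : ℕ) ≤ 1 / N := by
          rw [div_le_div_iff₀ (by positivity) (by positivity)]
          have : (j : ℝ) ≤ n := by exact_mod_cast hj.le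
          push_cast
          nlinarith [(Nat.cast_nonneg N : (0 : ℝ) ≤ N)]
        have hN' : (0 : ℝ) < N := by exact_mod_cast hN0
        calc (j : ℝ) / (N * n : ℕ) * ‖h‖ ≤ 1 / N * ‖h‖ := by gcongr
          _ < 1 / N * ρ := by gcongr
          _ ≤ r / 2 := by
            rw [div_lt_iff₀ hr] at hN
            rw [one_div, inv_mul_le_iff₀ hN']
            linarith
      · rw [hBdef, add_comm]
        refine add_le_add ?_ (eLpNorm_extrapolationError_le hK hA1.le (hc2 A hA1.le) hh'.le f)
        gcongr
        rw [hA, ← pow_mul]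
        exact hc1
  have h2 : eLpNorm f 2 volume ^ 2 ≤ (ENNReal.ofReal C * B) ^ 2 := by
    rw [mul_pow, hCsq, ENNReal.mul_comm_div, ← mul_div_assoc,
      ENNReal.le_div_iff_mul_le (Or.inl hv0) (Or.inl hvt), mul_comm]
    exact key
  exact (ENNReal.pow_le_pow_left_iff two_ne_zero).1 h2

end ObservabilitySets

/-! ### The bilinear `L²` pairing. -/

section Pairing

variable {E : Type*} [MeasurableSpace E] {μ : Measure E}

/-- The bilinear pairing `(f, w) ↦ ∫ f w` on `L²`. -/
noncomputable def pairingLp (μ : Measure E) : Lp ℂ 2 μ →L[ℂ] Lp ℂ 2 μ →L[ℂ] ℂ :=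
  (ContinuousLinearMap.mul ℂ ℂ).lpPairing μ 2 2

theorem pairingLp_apply (f w : Lp ℂ 2 μ) : pairingLp μ f w = ∫ z, f z * w z ∂μ := by
  rw [pairingLp, ContinuousLinearMap.lpPairing_eq_integral]
  rfl

theorem pairingLp_toLp (f : Lp ℂ 2 μ) {w : E → ℂ} (hw : MemLp w 2 μ) :
    pairingLp μ f hw.toLp = ∫ z, f z * w z ∂μ := by
  rw [pairingLp_apply]
  refine integral_congr_ae ?_
  filter_upwards [hw.coeFn_toLp] with z hz
  rw [hz]

theorem norm_integral_Lp_mul_le (f : Lp ℂ 2 μ) {w : E → ℂ} (hw : MemLp w 2 μ) :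
    ‖∫ z, f z * w z ∂μ‖ ≤ ‖pairingLp μ‖ * ‖f‖ * ‖hw.toLp‖ := by
  rw [← pairingLp_toLp]
  exact (pairingLp μ).le_opNorm₂ f _

theorem continuous_integral_Lp_mul {w : E → ℂ} (hw : MemLp w 2 μ) :
    Continuous fun f : Lp ℂ 2 μ => ∫ z, f z * w z ∂μ := by
  simp_rw [← pairingLp_toLp _ hw]
  fun_prop

end Pairing

/-! ### Schwartz test functions in the weak formulation. -/

section KolmogorovTranspose

open SchwartzMap LineDeriv
open scoped ContDiff

variable {d : ℕ}

theorem hasTemperateGrowth_coord (j : Fin d ⊕ Fin d) :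
    (fun z : Phase d => (z j : ℂ)).HasTemperateGrowth := by
  exact (Complex.ofRealCLM ∘L (EuclideanSpace.proj j : Phase d →L[ℝ] ℝ)).hasTemperateGrowth

/-- `∂φ/∂zⱼ` as a Schwartz function. -/
noncomputable def schwartzPartial (j : Fin d ⊕ Fin d) (φ : 𝓢(Phase d, ℂ)) : 𝓢(Phase d, ℂ) :=
  ∂_{(EuclideanSpace.single j (1 : ℝ) : Phase d)} φ

theorem coe_schwartzPartial (j : Fin d ⊕ Fin d) (φ : 𝓢(Phase d, ℂ)) :
    ⇑(schwartzPartial j φ) = partialDeriv j φ := rfl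

/-- `v · ∇ₓ φ + Δᵥ φ` as a Schwartz function. -/
noncomputable def kolmogorovSchwartz (φ : 𝓢(Phase d, ℂ)) : 𝓢(Phase d, ℂ) :=
  (∑ i : Fin d, smulLeftCLM ℂ (fun z : Phase d => (z (Sum.inr i) : ℂ))
    (schwartzPartial (Sum.inl i) φ)) +
    ∑ i : Fin d, schwartzPartial (Sum.inr i) (schwartzPartial (Sum.inr i) φ)

theorem kolmogorovTranspose_coe (φ : 𝓢(Phase d, ℂ)) :
    kolmogorovTranspose φ = kolmogorovSchwartz φ := by
  ext z
  simp only [kolmogorovTranspose, kolmogorovSchwartz, _root_.add_apply, _root_.sum_apply,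
    smulLeftCLM_apply_apply (hasTemperateGrowth_coord _), coe_schwartzPartial, smul_eq_mul]

theorem SchwartzMap.exists_norm_le (φ : 𝓢(Phase d, ℂ)) : ∃ M : ℝ, ∀ z, ‖φ z‖ ≤ M :=
  ⟨_, fun z => φ.norm_le_seminorm ℝ z⟩

theorem partialDeriv_mul (j : Fin d ⊕ Fin d) {u w : Phase d → ℂ} (hu : Differentiable ℝ u)
    (hw : Differentiable ℝ w) : partialDeriv j (fun z => u z * w z) =
      fun z => u z * partialDeriv j w z + partialDeriv j u z * w z := by
  ext z
  simp [partialDeriv, fderiv_fun_mul (hu z) (hw z), mul_comm]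

theorem partialDeriv_add (j : Fin d ⊕ Fin d) {u w : Phase d → ℂ} (hu : Differentiable ℝ u)
    (hw : Differentiable ℝ w) : partialDeriv j (fun z => u z + w z) =
      fun z => partialDeriv j u z + partialDeriv j w z := by
  ext z
  simp [partialDeriv, fderiv_fun_add (hu z) (hw z)]

theorem partialDeriv_comp_smul (j : Fin d ⊕ Fin d) (u : Phase d → ℂ) (ε : ℝ) :
    partialDeriv j (fun z => u (ε • z)) = fun z => (ε : ℂ) * partialDeriv j u (ε • z) := by
  ext z
  simp [partialDeriv, fderiv_comp_smul]

theorem partialDeriv_const_mul (j : Fin d ⊕ Fin d) {u : Phase d → ℂ} (hu : Differentiable ℝ u)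
    (c : ℂ) : partialDeriv j (fun z => c * u z) = fun z => c * partialDeriv j u z := by
  ext z
  simp [partialDeriv, fderiv_const_mul (hu z)]

theorem partialDeriv_cutoff (j : Fin d ⊕ Fin d) (u φ : 𝓢(Phase d, ℂ)) (ε : ℝ) :
    partialDeriv j (fun z => u (ε • z) * φ z) = fun z => u (ε • z) * partialDeriv j φ z +
      (ε : ℂ) * partialDeriv j u (ε • z) * φ z := by
  have hu : Differentiable ℝ fun z => u (ε • z) := u.differentiable.comp (by fun_prop)
  rw [partialDeriv_mul j hu φ.differentiable, partialDeriv_comp_smul]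

theorem partialDeriv_partialDeriv_cutoff (j : Fin d ⊕ Fin d) (u φ : 𝓢(Phase d, ℂ)) (ε : ℝ) :
    partialDeriv j (partialDeriv j (fun z => u (ε • z) * φ z)) = fun z =>
      u (ε • z) * partialDeriv j (partialDeriv j φ) z +
      2 * ((ε : ℂ) * partialDeriv j u (ε • z) * partialDeriv j φ z) +
      (ε : ℂ) ^ 2 * partialDeriv j (partialDeriv j u) (ε • z) * φ z := by
  have hd : ∀ w : 𝓢(Phase d, ℂ), Differentiable ℝ fun z => w (ε • z) := fun w =>
    w.differentiable.comp (by fun_prop)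
  set u' := schwartzPartial j u with hu'
  set φ' := schwartzPartial j φ with hφ'
  have e : partialDeriv j (fun z => u (ε • z) * φ z) = fun z =>
      u (ε • z) * φ' z + (ε : ℂ) * (u' (ε • z) * φ z) := by
    rw [partialDeriv_cutoff]
    ext z
    rw [← coe_schwartzPartial, ← coe_schwartzPartial, mul_assoc]
  have hu1 : Differentiable ℝ fun z => u (ε • z) * φ' z := (hd u).mul φ'.differentiable
  have hu2 : Differentiable ℝ fun z => u' (ε • z) * φ z := (hd u').mul φ.differentiable
  rw [e, partialDeriv_add j hu1 (hu2.const_mul _), partialDeriv_const_mul j hu2,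
    partialDeriv_cutoff, partialDeriv_cutoff]
  ext z
  simp only [hu', hφ', coe_schwartzPartial]
  ring

/-- A common majorant of `v · ∇ₓ (χ φ) + Δᵥ (χ φ)` over cutoffs `χ` with derivatives at most `M`. -/
noncomputable def cutoffMajorant (M : ℝ) (φ : 𝓢(Phase d, ℂ)) (z : Phase d) : ℝ :=
  (∑ i : Fin d, M * (‖(z (Sum.inr i) : ℂ) * partialDeriv (Sum.inl i) φ z‖ +
    ‖(z (Sum.inr i) : ℂ) * φ z‖)) +
  ∑ i : Fin d, M * (‖partialDeriv (Sum.inr i) (partialDeriv (Sum.inr i) φ) z‖ +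
    2 * ‖partialDeriv (Sum.inr i) φ z‖ + ‖φ z‖)

theorem memLp_cutoffMajorant (M : ℝ) (φ : 𝓢(Phase d, ℂ)) :
    MemLp (cutoffMajorant M φ) 2 (volume : Measure (Phase d)) := by
  have h1 : ∀ (i : Fin d) (w : 𝓢(Phase d, ℂ)),
      MemLp (fun z : Phase d => ‖(z (Sum.inr i) : ℂ) * w z‖) 2 volume := fun i w => by
    have := ((smulLeftCLM ℂ (fun z : Phase d => (z (Sum.inr i) : ℂ)) w).memLp 2 volume).norm
    simpa only [smulLeftCLM_apply_apply (hasTemperateGrowth_coord _), smul_eq_mul] using this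
  have h2 : ∀ w : 𝓢(Phase d, ℂ), MemLp (fun z => ‖w z‖) 2 (volume : Measure (Phase d)) :=
    fun w => (w.memLp 2 volume).norm
  have h3 : ∀ i : Fin d, MemLp (fun z : Phase d =>
      M * (‖(z (Sum.inr i) : ℂ) * partialDeriv (Sum.inl i) φ z‖ +
        ‖(z (Sum.inr i) : ℂ) * φ z‖)) 2 volume := fun i =>
    ((h1 i (schwartzPartial (Sum.inl i) φ)).add (h1 i φ)).const_mul M
  have h4 : ∀ i : Fin d, MemLp (fun z : Phase d =>
      M * (‖partialDeriv (Sum.inr i) (partialDeriv (Sum.inr i) φ) z‖ +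
        2 * ‖partialDeriv (Sum.inr i) φ z‖ + ‖φ z‖)) 2 volume := fun i =>
    (((h2 (schwartzPartial (Sum.inr i) (schwartzPartial (Sum.inr i) φ))).add
      ((h2 (schwartzPartial (Sum.inr i) φ)).const_mul 2)).add (h2 φ)).const_mul M
  exact (memLp_finsetSum _ fun i _ => h3 i).add (memLp_finsetSum _ fun i _ => h4 i)

/-- By the Leibniz rule, each derivative falling on the dilated cutoff costs a factor `ε ≤ 1`, so
the bound is uniform in `ε` and can serve for dominated convergence. -/
theorem norm_kolmogorovTranspose_cutoff_le {M : ℝ} {u : 𝓢(Phase d, ℂ)} (h0 : ∀ z, ‖u z‖ ≤ M)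
    (h1 : ∀ j z, ‖partialDeriv j u z‖ ≤ M)
    (h2 : ∀ j z, ‖partialDeriv j (partialDeriv j u) z‖ ≤ M) (φ : 𝓢(Phase d, ℂ)) {ε : ℝ}
    (hε0 : 0 ≤ ε) (hε1 : ε ≤ 1) (z : Phase d) :
    ‖kolmogorovTranspose (fun z => u (ε • z) * φ z) z‖ ≤ cutoffMajorant M φ z := by
  have hM : 0 ≤ M := (norm_nonneg _).trans (h0 0)
  have hε : ‖(ε : ℂ)‖ ≤ 1 := by
    rwa [Complex.norm_real, Real.norm_of_nonneg hε0]
  have hε1' : ∀ j, ‖(ε : ℂ) * partialDeriv j u (ε • z)‖ ≤ M := fun j => by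
    rw [norm_mul]
    exact (mul_le_mul hε (h1 j _) (norm_nonneg _) zero_le_one).trans (one_mul M).le
  have hε2' : ∀ j, ‖(ε : ℂ) ^ 2 * partialDeriv j (partialDeriv j u) (ε • z)‖ ≤ M := fun j => by
    rw [norm_mul, norm_pow]
    exact (mul_le_mul (pow_le_one₀ (norm_nonneg _) hε) (h2 j _) (norm_nonneg _)
      zero_le_one).trans (one_mul M).le
  refine (norm_add_le _ _).trans (add_le_add ?_ ?_)
  · refine (norm_sum_le _ _).trans (Finset.sum_le_sum fun i _ => ?_)
    rw [partialDeriv_cutoff]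
    have e : (z (Sum.inr i) : ℂ) * (u (ε • z) * partialDeriv (Sum.inl i) φ z +
        (ε : ℂ) * partialDeriv (Sum.inl i) u (ε • z) * φ z) =
        u (ε • z) * ((z (Sum.inr i) : ℂ) * partialDeriv (Sum.inl i) φ z) +
        (ε : ℂ) * partialDeriv (Sum.inl i) u (ε • z) * ((z (Sum.inr i) : ℂ) * φ z) := by ring
    rw [e, mul_add]
    refine (norm_add_le _ _).trans (add_le_add ?_ ?_)
    · rw [norm_mul]
      gcongr
      exact h0 _
    · rw [norm_mul _ ((z (Sum.inr i) : ℂ) * φ z)]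
      gcongr
      exact hε1' _
  · refine (norm_sum_le _ _).trans (Finset.sum_le_sum fun i _ => ?_)
    rw [partialDeriv_partialDeriv_cutoff, mul_add, mul_add]
    refine (norm_add₃_le).trans (add_le_add (add_le_add ?_ ?_) ?_)
    · rw [norm_mul]
      gcongr
      exact h0 _
    · rw [norm_mul, norm_mul _ (partialDeriv (Sum.inr i) φ z), mul_left_comm]
      simp only [Complex.norm_ofNat]
      gcongr
      exact hε1' _
    · rw [norm_mul _ (φ z)]
      gcongr
      exact hε2' _

theorem kolmogorovTranspose_congr {u w : Phase d → ℂ} {z : Phase d} (h : u =ᶠ[nhds z] w) :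
    kolmogorovTranspose u z = kolmogorovTranspose w z := by
  have h1 : ∀ j, partialDeriv j u =ᶠ[nhds z] partialDeriv j w := fun j => by
    filter_upwards [h.fderiv (𝕜 := ℝ)] with y hy
    simp only [partialDeriv, hy]
  have h2 : ∀ j, partialDeriv j (partialDeriv j u) z = partialDeriv j (partialDeriv j w) z :=
    fun j => by
      change fderiv ℝ _ z _ = fderiv ℝ _ z _
      rw [(h1 j).fderiv_eq]
  simp only [kolmogorovTranspose, h2, (h1 _).eq_of_nhds]

/-- Schwartz functions may be used as test functions for the Kolmogorov equation. -/
theorem IsKolmogorovSolution.weak_schwartz {g₀ : Lp ℂ 2 (volume : Measure (Phase d))}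
    {g : ℝ → Lp ℂ 2 (volume : Measure (Phase d))} (hg : IsKolmogorovSolution g₀ g)
    (φ : 𝓢(Phase d, ℂ)) {t : ℝ} (ht : 0 ≤ t) :
    (∫ z, g t z * φ z) - (∫ z, g₀ z * φ z) =
      ∫ s in (0 : ℝ)..t, ∫ z, g s z * kolmogorovSchwartz φ z := by
  -- The dilated cutoffs `χ (ε z)` equal `1` on balls of radius `1/ε`, and `ε` will tend to `0`.
  let χ : ContDiffBump (0 : Phase d) := ⟨1, 2, by norm_num, by norm_num⟩
  have hχs : HasCompactSupport fun z => (χ z : ℂ) := χ.hasCompactSupport.comp_left Complex.ofReal_zero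
  let u : 𝓢(Phase d, ℂ) := hχs.toSchwartzMap (Complex.ofRealCLM.contDiff.comp χ.contDiff)
  have hu : ∀ z, u z = (χ z : ℂ) := fun z => rfl
  obtain ⟨M, h0, h1, h2⟩ : ∃ M : ℝ, (∀ z, ‖u z‖ ≤ M) ∧ (∀ j z, ‖partialDeriv j u z‖ ≤ M) ∧
      ∀ j z, ‖partialDeriv j (partialDeriv j u) z‖ ≤ M := by
    obtain ⟨M0, hM0⟩ := u.exists_norm_le
    choose M1 hM1 using fun j : Fin d ⊕ Fin d =>
      (schwartzPartial j u).exists_norm_le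
    choose M2 hM2 using fun j : Fin d ⊕ Fin d => (schwartzPartial j
      (schwartzPartial j u)).exists_norm_le
    have p1 : ∀ j, 0 ≤ M1 j := fun j => (norm_nonneg _).trans (hM1 j 0)
    have p2 : ∀ j, 0 ≤ M2 j := fun j => (norm_nonneg _).trans (hM2 j 0)
    have p0 : 0 ≤ M0 := (norm_nonneg _).trans (hM0 0)
    have q1 : ∀ j, M1 j ≤ ∑ j, M1 j := fun j =>
      Finset.single_le_sum (fun i _ => p1 i) (Finset.mem_univ j)
    have q2 : ∀ j, M2 j ≤ ∑ j, M2 j := fun j =>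
      Finset.single_le_sum (fun i _ => p2 i) (Finset.mem_univ j)
    have s1 : 0 ≤ ∑ j, M1 j := Finset.sum_nonneg fun i _ => p1 i
    have s2 : 0 ≤ ∑ j, M2 j := Finset.sum_nonneg fun i _ => p2 i
    refine ⟨M0 + ∑ j, M1 j + ∑ j, M2 j, fun z => ?_, fun j z => ?_, fun j z => ?_⟩
    · linarith [hM0 z]
    · have : ‖partialDeriv j u z‖ ≤ M1 j := hM1 j z
      linarith [q1 j]
    · have : ‖partialDeriv j (partialDeriv j u) z‖ ≤ M2 j := hM2 j z
      linarith [q2 j]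
  let ε : ℕ → ℝ := fun n => 1 / ((n : ℝ) + 1)
  have hε0 : ∀ n, 0 ≤ ε n := fun n => by positivity
  have hε1 : ∀ n, ε n ≤ 1 := fun n => by
    simp only [ε]
    rw [div_le_one (by positivity)]
    linarith [(Nat.cast_nonneg n : (0 : ℝ) ≤ n)]
  have hεp : ∀ n, 0 < ε n := fun n => by positivity
  have hεlim : Filter.Tendsto ε Filter.atTop (nhds 0) := tendsto_one_div_add_atTop_nhds_zero_nat
  have hΦs : ∀ n, HasCompactSupport fun z => u (ε n • z) * φ z := fun n => by
    refine HasCompactSupport.mul_right ?_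
    exact hχs.comp_smul (hεp n).ne'
  have hΦd : ∀ n, ContDiff ℝ ∞ fun z => u (ε n • z) * φ z := fun n =>
    ((u.smooth ⊤).comp (contDiff_const_smul _)).mul (φ.smooth ⊤)
  let Φ : ℕ → 𝓢(Phase d, ℂ) := fun n => (hΦs n).toSchwartzMap (hΦd n)
  have hΦ : ∀ n, ⇑(Φ n) = fun z => u (ε n • z) * φ z := fun n => rfl
  -- Near each fixed point the truncated function eventually coincides with `φ`, so all pointwise
  -- limits are eventual equalities, derivatives included.
  have hev : ∀ z : Phase d, ∀ᶠ n in Filter.atTop, ⇑(Φ n) =ᶠ[nhds z] φ := by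
    intro z
    have hz : Filter.Tendsto (fun n => ε n • z) Filter.atTop (nhds 0) := by
      simpa using hεlim.smul_const z
    filter_upwards [hz.eventually (Metric.ball_mem_nhds (0 : Phase d) one_pos)] with n hn
    have hcont : Filter.Tendsto (fun y : Phase d => ε n • y) (nhds z) (nhds (ε n • z)) :=
      (continuous_const_smul (ε n)).tendsto z
    filter_upwards [hcont.eventually (Metric.isOpen_ball.mem_nhds hn)] with y hy
    have : χ (ε n • y) = 1 := χ.one_of_mem_closedBall (Metric.ball_subset_closedBall hy)
    rw [hΦ]
    simp [hu, this]
  have hbd : ∀ n z, ‖kolmogorovSchwartz (Φ n) z‖ ≤ cutoffMajorant M φ z := fun n z => by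
    rw [← kolmogorovTranspose_coe, hΦ]
    exact norm_kolmogorovTranspose_cutoff_le h0 h1 h2 φ (hε0 n) (hε1 n) z
  have hlim0 : ∀ f : Lp ℂ 2 (volume : Measure (Phase d)),
      Filter.Tendsto (fun n => ∫ z, f z * Φ n z) Filter.atTop (nhds (∫ z, f z * φ z)) := by
    intro f
    refine tendsto_integral_of_dominated_convergence (fun z => M * ‖f z * φ z‖)
      (fun n => (integrable_Lp_mul_schwartz f (Φ n)).1)
      ((integrable_Lp_mul_schwartz f φ).norm.const_mul M) (fun n => ?_) ?_
    · refine Filter.Eventually.of_forall fun z => ?_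
      rw [hΦ]
      simp only [norm_mul]
      rw [mul_left_comm]
      gcongr
      exact h0 _
    · refine Filter.Eventually.of_forall fun z => tendsto_const_nhds.congr' ?_
      filter_upwards [hev z] with n hn
      rw [hn.eq_of_nhds]
  have hlim1 : ∀ f : Lp ℂ 2 (volume : Measure (Phase d)),
      Filter.Tendsto (fun n => ∫ z, f z * kolmogorovSchwartz (Φ n) z) Filter.atTop
        (nhds (∫ z, f z * kolmogorovSchwartz φ z)) := by
    intro f
    refine tendsto_integral_of_dominated_convergence (fun z => ‖f z‖ * cutoffMajorant M φ z)
      (fun n => (integrable_Lp_mul_schwartz f _).1)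
      (MemLp.integrable_mul (Lp.memLp f).norm (memLp_cutoffMajorant M φ)) (fun n => ?_) ?_
    · refine Filter.Eventually.of_forall fun z => ?_
      rw [norm_mul]
      gcongr
      exact hbd n z
    · refine Filter.Eventually.of_forall fun z => tendsto_const_nhds.congr' ?_
      filter_upwards [hev z] with n hn
      rw [← kolmogorovTranspose_coe, ← kolmogorovTranspose_coe, kolmogorovTranspose_congr hn]
  have hcont : ∀ w : 𝓢(Phase d, ℂ),
      ContinuousOn (fun s => ∫ z, g s z * w z) (Set.Icc 0 t) := fun w =>
    (continuous_integral_Lp_mul (w.memLp 2 volume)).comp_continuousOn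
      (hg.continuousOn.mono Set.Icc_subset_Ici_self)
  obtain ⟨B, hB⟩ : ∃ B, ∀ s ∈ Set.Icc 0 t, ‖g s‖ ≤ B :=
    isCompact_Icc.exists_bound_of_continuousOn (hg.continuousOn.mono Set.Icc_subset_Ici_self)
  have hI : Filter.Tendsto (fun n => ∫ s in (0 : ℝ)..t, ∫ z, g s z * kolmogorovSchwartz (Φ n) z)
      Filter.atTop (nhds (∫ s in (0 : ℝ)..t, ∫ z, g s z * kolmogorovSchwartz φ z)) := by
    have hu : Set.uIoc 0 t = Set.Ioc 0 t := Set.uIoc_of_le ht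
    refine intervalIntegral.tendsto_integral_filter_of_dominated_convergence
      (fun _ => ‖pairingLp (volume : Measure (Phase d))‖ * B *
        ‖(memLp_cutoffMajorant M φ).toLp‖) ?_ ?_ intervalIntegrable_const ?_
    · refine Filter.Eventually.of_forall fun n => ?_
      rw [hu]
      exact ((hcont _).mono Set.Ioc_subset_Icc_self).aestronglyMeasurable measurableSet_Ioc
    · refine Filter.Eventually.of_forall fun n => Filter.Eventually.of_forall fun s hs => ?_
      rw [hu] at hs
      refine (norm_integral_Lp_mul_le (g s) ((kolmogorovSchwartz (Φ n)).memLp 2 volume)).trans ?_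
      refine mul_le_mul (mul_le_mul_of_nonneg_left (hB s (Set.Ioc_subset_Icc_self hs))
        (pairingLp _).opNorm_nonneg) ?_ (norm_nonneg _) (mul_nonneg (pairingLp _).opNorm_nonneg
          ((norm_nonneg _).trans (hB s (Set.Ioc_subset_Icc_self hs))))
      refine Lp.norm_le_norm_of_ae_le ?_
      filter_upwards [((kolmogorovSchwartz (Φ n)).memLp 2 volume).coeFn_toLp,
        (memLp_cutoffMajorant M φ).coeFn_toLp] with z a b
      rw [a, b]
      exact (hbd n z).trans (le_abs_self _)
    · exact Filter.Eventually.of_forall fun s _ => hlim1 (g s)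
  refine tendsto_nhds_unique ((hlim0 (g t)).sub (hlim0 g₀)) (hI.congr fun n => ?_)
  have := hg.weak (Φ n) (hΦd n) (hΦs n) t ht
  rw [kolmogorovTranspose_coe] at this
  exact this.symm

end KolmogorovTranspose

/-! ### Shears, and the equation on the frequency side. -/

section Shear

open SchwartzMap FourierTransform LineDeriv
open scoped ContDiff

variable {d : ℕ}

/-- The nilpotent map `(ξ, η) ↦ (0, ξ)`. -/
noncomputable def shearGenerator (d : ℕ) : Phase d →L[ℝ] Phase d :=
  Matrix.toEuclideanCLM (𝕜 := ℝ) (Matrix.fromBlocks 0 0 1 0)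

/-- The shear `(ξ, η) ↦ (ξ, η + t ξ)`. -/
noncomputable def shear (t : ℝ) : Phase d →L[ℝ] Phase d :=
  ContinuousLinearMap.id ℝ _ + t • shearGenerator d

theorem shearGenerator_inl (ζ : Phase d) (i : Fin d) : shearGenerator d ζ (Sum.inl i) = 0 := by
  simp [shearGenerator, Matrix.fromBlocks_mulVec]

theorem shearGenerator_inr (ζ : Phase d) (i : Fin d) :
    shearGenerator d ζ (Sum.inr i) = ζ (Sum.inl i) := by
  simp [shearGenerator, Matrix.fromBlocks_mulVec]

theorem shear_apply (t : ℝ) (ζ : Phase d) : shear t ζ = ζ + t • shearGenerator d ζ := by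
  simp [shear]

theorem shear_inl (t : ℝ) (ζ : Phase d) (i : Fin d) : shear t ζ (Sum.inl i) = ζ (Sum.inl i) := by
  simp [shear_apply, shearGenerator_inl]

theorem shear_inr (t : ℝ) (ζ : Phase d) (i : Fin d) :
    shear t ζ (Sum.inr i) = ζ (Sum.inr i) + t * ζ (Sum.inl i) := by
  simp [shear_apply, shearGenerator_inr]

theorem shearGenerator_shear (t : ℝ) (ζ : Phase d) :
    shearGenerator d (shear t ζ) = shearGenerator d ζ := by
  ext j
  rcases j with i | i <;> simp [shearGenerator_inl, shearGenerator_inr, shear_inl]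

theorem shear_shear (s t : ℝ) (ζ : Phase d) : shear s (shear t ζ) = shear (s + t) ζ := by
  rw [shear_apply s, shearGenerator_shear, shear_apply, shear_apply, add_smul]
  abel

theorem shear_zero (ζ : Phase d) : shear 0 ζ = ζ := by simp [shear_apply]

theorem norm_le_of_shear {τ t : ℝ} (ht : |t| ≤ τ) (ζ : Phase d) :
    ‖ζ‖ ≤ (1 + τ * ‖shearGenerator d‖) * ‖shear t ζ‖ := by
  have h : ζ = shear t ζ + (-t) • shearGenerator d (shear t ζ) := by
    rw [← shear_apply, shear_shear, neg_add_cancel, shear_zero]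
  calc ‖ζ‖ = ‖shear t ζ + (-t) • shearGenerator d (shear t ζ)‖ := congrArg _ h
    _ ≤ ‖shear t ζ‖ + τ * (‖shearGenerator d‖ * ‖shear t ζ‖) := by
        refine (norm_add_le _ _).trans (add_le_add le_rfl ?_)
        rw [norm_smul, norm_neg, Real.norm_eq_abs]
        exact mul_le_mul ht (ContinuousLinearMap.le_opNorm _ _) (norm_nonneg _)
          ((abs_nonneg t).trans ht)
    _ = _ := by ring

theorem measurePreserving_shear (t : ℝ) :
    MeasurePreserving (shear t : Phase d → Phase d) volume volume := by
  let M : Matrix (Fin d ⊕ Fin d) (Fin d ⊕ Fin d) ℝ := Matrix.fromBlocks 1 0 (t • 1) 1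
  have hM : M.det = 1 := by simp [M]
  have h1 : MeasurePreserving (Matrix.toLin' M) volume volume := by
    refine ⟨(LinearMap.continuous_of_finiteDimensional _).measurable, ?_⟩
    rw [Real.map_matrix_volume_pi_eq_smul_volume_pi (by rw [hM]; exact one_ne_zero), hM]
    simp
  have h2 := (EuclideanSpace.volume_preserving_symm_measurableEquiv_toLp (Fin d ⊕ Fin d)).symm
  have h3 := (h2.comp h1).comp
    (EuclideanSpace.volume_preserving_symm_measurableEquiv_toLp (Fin d ⊕ Fin d))
  have e : (shear t : Phase d → Phase d) = ((MeasurableEquiv.toLp 2 (Fin d ⊕ Fin d → ℝ)).symm.symm ∘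
      Matrix.toLin' M) ∘ (MeasurableEquiv.toLp 2 (Fin d ⊕ Fin d → ℝ)).symm := by
    funext ζ
    refine PiLp.ext fun j => ?_
    rcases j with i | i
    · simp [M, shear_inl, Matrix.fromBlocks_mulVec]
    · simp [M, shear_inr, Matrix.fromBlocks_mulVec, Matrix.smul_mulVec, add_comm]
  rw [e]
  exact h3

theorem shearGenerator_eq_sum (ζ : Phase d) : shearGenerator d ζ =
    ∑ i : Fin d, ζ (Sum.inl i) • (EuclideanSpace.single (Sum.inr i) (1 : ℝ) : Phase d) := by
  ext j
  rcases j with i | i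
  · simp [shearGenerator_inl]
  · simp [shearGenerator_inr, Pi.single_apply]

theorem fderiv_shearGenerator (b : Phase d → ℂ) (w ζ : Phase d) :
    fderiv ℝ b w (shearGenerator d ζ) =
      ∑ i : Fin d, (ζ (Sum.inl i) : ℂ) * partialDeriv (Sum.inr i) b w := by
  simp [shearGenerator_eq_sum, map_sum, partialDeriv]

/-- The Fourier side of `v · ∇ₓ + Δᵥ`: the operator `-ξ · ∇_η - 4π² |η|²`. -/
noncomputable def frequencyGenerator (b : 𝓢(Phase d, ℂ)) : 𝓢(Phase d, ℂ) :=
  -(∑ i : Fin d, smulLeftCLM ℂ (fun z : Phase d => (z (Sum.inl i) : ℂ))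
    (schwartzPartial (Sum.inr i) b)) - ((4 * Real.pi ^ 2 : ℝ) : ℂ) •
    ∑ i : Fin d, smulLeftCLM ℂ (fun z : Phase d => (z (Sum.inr i) : ℂ))
      (smulLeftCLM ℂ (fun z : Phase d => (z (Sum.inr i) : ℂ)) b)

theorem frequencyGenerator_apply (b : 𝓢(Phase d, ℂ)) (ζ : Phase d) :
    frequencyGenerator b ζ = -fderiv ℝ b ζ (shearGenerator d ζ) -
      ((4 * Real.pi ^ 2 * ∑ i : Fin d, ζ (Sum.inr i) ^ 2 : ℝ) : ℂ) * b ζ := by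
  rw [fderiv_shearGenerator]
  simp only [frequencyGenerator, _root_.sub_apply, _root_.neg_apply, _root_.sum_apply,
    _root_.smul_apply, smulLeftCLM_apply_apply (hasTemperateGrowth_coord _), coe_schwartzPartial,
    smul_eq_mul]
  congr 1
  push_cast
  rw [Finset.mul_sum, Finset.mul_sum, Finset.sum_mul]
  exact Finset.sum_congr rfl fun i _ => by ring

theorem inner_single_coord (j : Fin d ⊕ Fin d) (ζ : Phase d) :
    inner ℝ ζ (EuclideanSpace.single j (1 : ℝ) : Phase d) = ζ j := by
  simp [EuclideanSpace.inner_single_right]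

theorem smulLeftCLM_inner_single (j : Fin d ⊕ Fin d) (b : 𝓢(Phase d, ℂ)) :
    smulLeftCLM ℂ (fun ζ : Phase d => inner ℝ ζ (EuclideanSpace.single j (1 : ℝ) : Phase d)) b =
      smulLeftCLM ℂ (fun z : Phase d => (z j : ℂ)) b := by
  have : (fun ζ : Phase d => inner ℝ ζ
    (EuclideanSpace.single j (1 : ℝ) : Phase d)).HasTemperateGrowth := by fun_prop
  ext ζ
  rw [smulLeftCLM_apply_apply this, smulLeftCLM_apply_apply (hasTemperateGrowth_coord _),
    inner_single_coord]
  simp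

theorem schwartzPartial_fourier (j : Fin d ⊕ Fin d) (b : 𝓢(Phase d, ℂ)) :
    schwartzPartial j (𝓕 b) = -(2 * Real.pi * Complex.I) •
      𝓕 (smulLeftCLM ℂ (fun z : Phase d => (z j : ℂ)) b) := by
  rw [schwartzPartial, lineDerivOp_fourier_eq, smulLeftCLM_inner_single, FourierTransform.fourier_smul]

theorem fourier_schwartzPartial (j : Fin d ⊕ Fin d) (b : 𝓢(Phase d, ℂ)) :
    𝓕 (schwartzPartial j b) = (2 * Real.pi * Complex.I) •
      smulLeftCLM ℂ (fun z : Phase d => (z j : ℂ)) (𝓕 b) := by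
  rw [schwartzPartial, fourier_lineDerivOp_eq, smulLeftCLM_inner_single]

theorem schwartzPartial_smulLeftCLM_of_ne {j k : Fin d ⊕ Fin d} (hjk : k ≠ j) (b : 𝓢(Phase d, ℂ)) :
    schwartzPartial j (smulLeftCLM ℂ (fun z : Phase d => (z k : ℂ)) b) =
      smulLeftCLM ℂ (fun z : Phase d => (z k : ℂ)) (schwartzPartial j b) := by
  ext ζ
  have hd : HasFDerivAt (fun z : Phase d => (z k : ℂ))
      (Complex.ofRealCLM ∘L (EuclideanSpace.proj k : Phase d →L[ℝ] ℝ)) ζ :=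
    (Complex.ofRealCLM ∘L (EuclideanSpace.proj k : Phase d →L[ℝ] ℝ)).hasFDerivAt
  have hz : partialDeriv j (fun z : Phase d => (z k : ℂ)) ζ = 0 := by
    rw [partialDeriv, hd.fderiv]
    simp [hjk]
  rw [smulLeftCLM_apply_apply (hasTemperateGrowth_coord _), coe_schwartzPartial,
    smulLeftCLM_apply (hasTemperateGrowth_coord _), coe_schwartzPartial]
  simp only [smul_eq_mul]
  rw [partialDeriv_mul j (by fun_prop) b.differentiable]
  simp [hz]

/-- Differentiation in `x` becomes multiplication by `-2πiξ`, and multiplication by `v` becomes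
`(2πi)⁻¹ ∂_η`; as `ξ` and `∂_η` commute, the constants combine to `-1`. -/
theorem kolmogorovSchwartz_fourier (b : 𝓢(Phase d, ℂ)) :
    kolmogorovSchwartz (𝓕 b) = 𝓕 (frequencyGenerator b) := by
  have h1 : ∀ i : Fin d, smulLeftCLM ℂ (fun z : Phase d => (z (Sum.inr i) : ℂ))
      (schwartzPartial (Sum.inl i) (𝓕 b)) =
      -𝓕 (smulLeftCLM ℂ (fun z : Phase d => (z (Sum.inl i) : ℂ))
        (schwartzPartial (Sum.inr i) b)) := by
    intro i
    rw [schwartzPartial_fourier, ← schwartzPartial_smulLeftCLM_of_ne Sum.inl_ne_inr,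
      fourier_schwartzPartial, map_smul, neg_smul]
  have h2 : ∀ i : Fin d, schwartzPartial (Sum.inr i) (schwartzPartial (Sum.inr i) (𝓕 b)) =
      -(((4 * Real.pi ^ 2 : ℝ) : ℂ) • 𝓕 (smulLeftCLM ℂ (fun z : Phase d => (z (Sum.inr i) : ℂ))
        (smulLeftCLM ℂ (fun z : Phase d => (z (Sum.inr i) : ℂ)) b))) := by
    intro i
    rw [schwartzPartial_fourier, ← FourierTransform.fourier_smul, schwartzPartial_fourier,
      map_smul, FourierTransform.fourier_smul, smul_smul, ← neg_smul]
    congr 1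
    push_cast
    linear_combination (4 * (Real.pi : ℂ) ^ 2) * Complex.I_sq
  have hF : ∀ c : 𝓢(Phase d, ℂ), 𝓕 c = fourierCLM ℂ 𝓢(Phase d, ℂ) c := fun _ => rfl
  rw [kolmogorovSchwartz, frequencyGenerator]
  simp only [h1, h2]
  simp only [hF, Finset.sum_neg_distrib, map_sub, map_neg, map_sum, map_smul,
    Finset.smul_sum]
  rw [sub_eq_add_neg]

end Shear

/-! ### Dissipation and the dual transport flow. -/

section FrequencyFlow

open SchwartzMap FourierTransform
open scoped ContDiff

variable {d : ℕ}

/-- The accumulated dissipation `∫₀ᵗ |η + s ξ|² ds`. -/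
noncomputable def dissipation (t : ℝ) (ζ : Phase d) : ℝ :=
  t * (∑ i : Fin d, ζ (Sum.inr i) ^ 2) + t ^ 2 * (∑ i : Fin d, ζ (Sum.inr i) * ζ (Sum.inl i)) +
    t ^ 3 / 3 * ∑ i : Fin d, ζ (Sum.inl i) ^ 2

theorem norm_sq_phase (ζ : Phase d) :
    ‖ζ‖ ^ 2 = (∑ i : Fin d, ζ (Sum.inl i) ^ 2) + ∑ i : Fin d, ζ (Sum.inr i) ^ 2 := by
  simp [EuclideanSpace.norm_sq_eq]

theorem le_dissipation {t : ℝ} (ht : 0 < t) (ζ : Phase d) :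
    min t (t ^ 3) / 21 * ‖ζ‖ ^ 2 ≤ dissipation t ζ := by
  rw [norm_sq_phase]
  have h : (t / 8) * (∑ i : Fin d, ζ (Sum.inr i) ^ 2) +
      (t ^ 3 / 21) * ∑ i : Fin d, ζ (Sum.inl i) ^ 2 ≤ dissipation t ζ := by
    -- Completing the square with `7/8` of the `η` term leaves `1 - 7/8 = 1/8` for `η` and `1/3 -
    -- 2/7 = 1/21` for `ξ`.
    have : 0 ≤ ∑ i : Fin d, t * (7 / 8) * (ζ (Sum.inr i) + 4 / 7 * t * ζ (Sum.inl i)) ^ 2 :=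
      Finset.sum_nonneg fun i _ => by positivity
    have e : ∑ i : Fin d, t * (7 / 8) * (ζ (Sum.inr i) + 4 / 7 * t * ζ (Sum.inl i)) ^ 2 =
        t * (7 / 8) * (∑ i : Fin d, ζ (Sum.inr i) ^ 2) +
        t ^ 2 * (∑ i : Fin d, ζ (Sum.inr i) * ζ (Sum.inl i)) +
        t ^ 3 * (2 / 7) * ∑ i : Fin d, ζ (Sum.inl i) ^ 2 := by
      rw [Finset.mul_sum, Finset.mul_sum, Finset.mul_sum, ← Finset.sum_add_distrib,
        ← Finset.sum_add_distrib]
      exact Finset.sum_congr rfl fun i _ => by ring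
    rw [e] at this
    rw [dissipation]
    linarith
  refine le_trans ?_ h
  have h1 : 0 ≤ ∑ i : Fin d, ζ (Sum.inr i) ^ 2 := Finset.sum_nonneg fun i _ => sq_nonneg _
  have h2 : 0 ≤ ∑ i : Fin d, ζ (Sum.inl i) ^ 2 := Finset.sum_nonneg fun i _ => sq_nonneg _
  have h3 : min t (t ^ 3) / 21 ≤ t / 8 := by linarith [min_le_left t (t ^ 3)]
  have h4 : min t (t ^ 3) / 21 ≤ t ^ 3 / 21 := by linarith [min_le_right t (t ^ 3)]
  rw [mul_add, add_comm]
  gcongr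

theorem dissipation_nonneg {t : ℝ} (ht : 0 ≤ t) (ζ : Phase d) : 0 ≤ dissipation t ζ := by
  rcases ht.eq_or_lt with rfl | ht
  · simp [dissipation]
  · exact le_trans (by positivity) (le_dissipation ht ζ)

theorem sum_sq_add_mul (s : ℝ) (a b : Fin d → ℝ) : ∑ i, (a i + s * b i) ^ 2 =
    ∑ i, a i ^ 2 + 2 * s * (∑ i, a i * b i) + s ^ 2 * ∑ i, b i ^ 2 := by
  rw [Finset.mul_sum, Finset.mul_sum, ← Finset.sum_add_distrib, ← Finset.sum_add_distrib]
  exact Finset.sum_congr rfl fun i _ => by ring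

theorem hasDerivAt_dissipation (t : ℝ) (ζ : Phase d) : HasDerivAt (fun t => dissipation t ζ)
    (∑ i : Fin d, (ζ (Sum.inr i) + t * ζ (Sum.inl i)) ^ 2) t := by
  have h := (((hasDerivAt_id t).mul_const (∑ i : Fin d, ζ (Sum.inr i) ^ 2)).add
    ((hasDerivAt_pow 2 t).mul_const (∑ i : Fin d, ζ (Sum.inr i) * ζ (Sum.inl i)))).add
    (((hasDerivAt_pow 3 t).div_const 3).mul_const (∑ i : Fin d, ζ (Sum.inl i) ^ 2))
  refine h.congr_deriv ?_
  rw [sum_sq_add_mul]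
  norm_num

/-- Shearing by `s` moves the window of integration to `[s, s + t]`, so the derivative is the
difference of the integrand at the two ends. -/
theorem hasDerivAt_dissipation_shear (t : ℝ) (ζ : Phase d) :
    HasDerivAt (fun s => dissipation t (shear s ζ))
      ((∑ i : Fin d, (ζ (Sum.inr i) + t * ζ (Sum.inl i)) ^ 2) - ∑ i : Fin d, ζ (Sum.inr i) ^ 2)
      0 := by
  set P := ∑ i : Fin d, ζ (Sum.inr i) ^ 2 with hP
  set Q := ∑ i : Fin d, ζ (Sum.inr i) * ζ (Sum.inl i) with hQ
  set S := ∑ i : Fin d, ζ (Sum.inl i) ^ 2 with hS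
  have e : (fun s => dissipation t (shear s ζ)) = fun s =>
      (t * P + t ^ 2 * Q + t ^ 3 / 3 * S) + s * (2 * t * Q + t ^ 2 * S) + s ^ 2 * (t * S) := by
    funext s
    have e1 : ∑ i : Fin d, (ζ (Sum.inr i) + s * ζ (Sum.inl i)) * ζ (Sum.inl i) = Q + s * S := by
      rw [hQ, hS, Finset.mul_sum, ← Finset.sum_add_distrib]
      exact Finset.sum_congr rfl fun i _ => by ring
    simp only [dissipation, shear_inl, shear_inr]
    rw [sum_sq_add_mul, e1, ← hP, ← hQ, ← hS]
    ring
  rw [e, sum_sq_add_mul, ← hP, ← hQ, ← hS]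
  have h := (((hasDerivAt_id (0 : ℝ)).mul_const (2 * t * Q + t ^ 2 * S)).const_add
    (t * P + t ^ 2 * Q + t ^ 3 / 3 * S)).add ((hasDerivAt_pow 2 (0 : ℝ)).mul_const (t * S))
  refine h.congr_deriv ?_
  simp
  ring

/-- The solution `b (ξ, η + t ξ) exp (4π² ∫₀ᵗ |η + s ξ|² ds)` of the transport equation dual to the
Fourier transform of the Kolmogorov equation. -/
noncomputable def frequencyFlow (b : Phase d → ℂ) (t : ℝ) (ζ : Phase d) : ℂ :=
  b (shear t ζ) * (Real.exp (4 * Real.pi ^ 2 * dissipation t ζ) : ℂ)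

/-- The time derivative of `frequencyFlow`. -/
noncomputable def frequencyFlowDeriv (b : Phase d → ℂ) (t : ℝ) (ζ : Phase d) : ℂ :=
  (fderiv ℝ b (shear t ζ) (shearGenerator d ζ) +
    ((4 * Real.pi ^ 2 * ∑ i : Fin d, (ζ (Sum.inr i) + t * ζ (Sum.inl i)) ^ 2 : ℝ) : ℂ) *
      b (shear t ζ)) * (Real.exp (4 * Real.pi ^ 2 * dissipation t ζ) : ℂ)

theorem hasDerivAt_comp_shear (b : 𝓢(Phase d, ℂ)) (t : ℝ) (ζ : Phase d) :
    HasDerivAt (fun t => b (shear t ζ)) (fderiv ℝ b (shear t ζ) (shearGenerator d ζ)) t := by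
  have h : HasDerivAt (fun t => shear t ζ) (shearGenerator d ζ) t := by
    simp_rw [shear_apply]
    simpa using ((hasDerivAt_id t).smul_const (shearGenerator d ζ)).const_add ζ
  exact (b.hasFDerivAt (shear t ζ)).comp_hasDerivAt t h

theorem hasDerivAt_frequencyFlow (b : 𝓢(Phase d, ℂ)) (t : ℝ) (ζ : Phase d) :
    HasDerivAt (fun t => frequencyFlow b t ζ) (frequencyFlowDeriv b t ζ) t := by
  have h := (hasDerivAt_comp_shear b t ζ).mul
    (((hasDerivAt_dissipation t ζ).const_mul (4 * Real.pi ^ 2)).exp.ofReal_comp)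
  refine h.congr_deriv ?_
  simp only [frequencyFlowDeriv]
  push_cast
  ring

theorem continuous_dissipation : Continuous fun p : ℝ × Phase d => dissipation p.1 p.2 := by
  unfold dissipation
  fun_prop

theorem continuous_shear : Continuous fun p : ℝ × Phase d => shear p.1 p.2 := by
  simp_rw [shear_apply]
  fun_prop

theorem continuous_frequencyFlowDeriv (b : 𝓢(Phase d, ℂ)) :
    Continuous fun p : ℝ × Phase d => frequencyFlowDeriv b p.1 p.2 := by
  have h1 : Continuous (fderiv ℝ b) := (b.smooth 1).continuous_fderiv one_ne_zero
  have h2 := continuous_shear (d := d)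
  have h3 := continuous_dissipation (d := d)
  have h4 : Continuous fun p : ℝ × Phase d => fderiv ℝ b (shear p.1 p.2) (shearGenerator d p.2) :=
    (h1.comp h2).clm_apply (by fun_prop)
  have h5 : Continuous fun p : ℝ × Phase d => b (shear p.1 p.2) := b.continuous.comp h2
  unfold frequencyFlowDeriv
  refine (h4.add (Continuous.mul ?_ h5)).mul ?_
  · fun_prop
  · exact Complex.continuous_ofReal.comp (Real.continuous_exp.comp (continuous_const.mul h3))

theorem contDiff_frequencyFlow {b : Phase d → ℂ} (hb : ContDiff ℝ ∞ b) (t : ℝ) :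
    ContDiff ℝ ∞ (frequencyFlow b t) := by
  have h : ContDiff ℝ ∞ (dissipation t : Phase d → ℝ) := by
    unfold dissipation
    fun_prop
  exact (hb.comp (shear t).contDiff).mul (Complex.ofRealCLM.contDiff.comp
    (Real.contDiff_exp.comp (contDiff_const.mul h)))

/-- The flow spreads supports in a locally bounded way. -/
theorem exists_radius_of_hasCompactSupport {b : Phase d → ℂ} (hb : HasCompactSupport b) (τ : ℝ) :
    ∃ R : ℝ, ∀ t, |t| ≤ τ → ∀ ζ, ζ ∉ Metric.closedBall 0 R →
      b (shear t ζ) = 0 ∧ fderiv ℝ b (shear t ζ) = 0 := by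
  obtain ⟨R₀, hR₀⟩ := hb.isCompact.isBounded.subset_closedBall (0 : Phase d)
  refine ⟨(1 + τ * ‖shearGenerator d‖) * R₀, fun t ht ζ hζ => ?_⟩
  have hτ : 0 ≤ τ := (abs_nonneg t).trans ht
  have hn : shear t ζ ∉ tsupport b := fun h => hζ <| by
    rw [mem_closedBall_zero_iff]
    refine (norm_le_of_shear ht ζ).trans ?_
    gcongr
    exact mem_closedBall_zero_iff.1 (hR₀ h)
  exact ⟨image_eq_zero_of_notMem_tsupport hn,
    image_eq_zero_of_notMem_tsupport fun h => hn (tsupport_fderiv_subset ℝ h)⟩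

theorem hasCompactSupport_frequencyFlow {b : Phase d → ℂ} (hb : HasCompactSupport b) (t : ℝ) :
    HasCompactSupport (frequencyFlow b t) := by
  obtain ⟨R, hR⟩ := exists_radius_of_hasCompactSupport hb |t|
  refine HasCompactSupport.intro (isCompact_closedBall (0 : Phase d) R) fun ζ hζ => ?_
  rw [frequencyFlow, (hR t le_rfl ζ hζ).1, zero_mul]

/-- `frequencyFlow` as a Schwartz function. -/
noncomputable def frequencyFlowSchwartz {b : 𝓢(Phase d, ℂ)} (hb : HasCompactSupport b) (t : ℝ) :
    𝓢(Phase d, ℂ) :=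
  (hasCompactSupport_frequencyFlow hb t).toSchwartzMap (contDiff_frequencyFlow (b.smooth ⊤) t)

theorem coe_frequencyFlowSchwartz {b : 𝓢(Phase d, ℂ)} (hb : HasCompactSupport b) (t : ℝ) :
    ⇑(frequencyFlowSchwartz hb t) = frequencyFlow b t := rfl

/-- This is the dual equation: the time derivative of the flow cancels the generator in the pairing
with `𝓕 (g t)`. -/
theorem frequencyGenerator_frequencyFlow {b : 𝓢(Phase d, ℂ)} (hb : HasCompactSupport b) (t : ℝ)
    (ζ : Phase d) :
    frequencyGenerator (frequencyFlowSchwartz hb t) ζ = -frequencyFlowDeriv b t ζ := by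
  -- The derivative along `ξ · ∂_η` is the derivative at `s = 0` along the shears; `h1` and `h3`
  -- compute it in two ways.
  have h1 := hasDerivAt_comp_shear (frequencyFlowSchwartz hb t) 0 ζ
  have h2 : HasDerivAt (fun s => b (shear t (shear s ζ)))
      (fderiv ℝ b (shear t ζ) (shearGenerator d ζ)) 0 := by
    simp_rw [shear_shear]
    have := hasDerivAt_comp_shear b (t + 0) ζ
    simpa using this.comp_const_add t 0
  have h3 := h2.mul
    (((hasDerivAt_dissipation_shear t ζ).const_mul (4 * Real.pi ^ 2)).exp.ofReal_comp)
  have h4 := h1.unique h3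
  rw [shear_zero] at h4
  rw [frequencyGenerator_apply, h4, coe_frequencyFlowSchwartz, frequencyFlow, frequencyFlowDeriv]
  push_cast
  ring

theorem exists_bound_frequencyFlowDeriv {b : 𝓢(Phase d, ℂ)} (hb : HasCompactSupport b) (τ : ℝ) :
    ∃ M R : ℝ, ∀ t, |t| ≤ τ → ∀ ζ,
      ‖frequencyFlowDeriv b t ζ‖ ≤ (Metric.closedBall (0 : Phase d) R).indicator (fun _ => M) ζ := by
  obtain ⟨R, hR⟩ := exists_radius_of_hasCompactSupport hb τ
  obtain ⟨M, hM⟩ := ((isCompact_Icc (a := -τ) (b := τ)).prod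
    (isCompact_closedBall (0 : Phase d) R)).exists_bound_of_continuousOn
    (continuous_frequencyFlowDeriv b).continuousOn
  refine ⟨M, R, fun t ht ζ => ?_⟩
  by_cases hζ : ζ ∈ Metric.closedBall (0 : Phase d) R
  · rw [Set.indicator_of_mem hζ]
    exact hM (t, ζ) ⟨abs_le.1 ht, hζ⟩
  · rw [Set.indicator_of_notMem hζ, frequencyFlowDeriv, (hR t ht ζ hζ).1, (hR t ht ζ hζ).2]
    simp

theorem memLp_indicator_closedBall (M R : ℝ) :
    MemLp ((Metric.closedBall (0 : Phase d) R).indicator fun _ => M) 2 volume :=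
  memLp_indicator_const 2 measurableSet_closedBall M
    (Or.inr (measure_closedBall_lt_top (x := (0 : Phase d))).ne)

/-- Pointwise mean value inequality, with a derivative bounded and supported in one fixed ball. The
product rule for the pairing needs this strong Lipschitz bound because `g` is only continuous in
`L²`. -/
theorem exists_lipschitz_frequencyFlow {b : 𝓢(Phase d, ℂ)} (hb : HasCompactSupport b) (τ : ℝ) :
    ∃ L : ℝ, ∀ s t, |s| ≤ τ → |t| ≤ τ →
      ‖(frequencyFlowSchwartz hb s).toLp 2 volume - (frequencyFlowSchwartz hb t).toLp 2 volume‖ ≤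
        L * |s - t| := by
  obtain ⟨M, R, hMR⟩ := exists_bound_frequencyFlowDeriv hb τ
  refine ⟨‖(memLp_indicator_closedBall (d := d) M R).toLp‖, fun s t hs ht => ?_⟩
  rw [← Real.norm_eq_abs (s - t), mul_comm, ← norm_smul]
  refine Lp.norm_le_norm_of_ae_le ?_
  filter_upwards [Lp.coeFn_sub ((frequencyFlowSchwartz hb s).toLp 2 volume)
      ((frequencyFlowSchwartz hb t).toLp 2 volume),
    (frequencyFlowSchwartz hb s).coeFn_toLp 2 volume,
    (frequencyFlowSchwartz hb t).coeFn_toLp 2 volume,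
    Lp.coeFn_smul (s - t) (memLp_indicator_closedBall (d := d) M R).toLp,
    (memLp_indicator_closedBall (d := d) M R).coeFn_toLp] with ζ h1 h2 h3 h4 h5
  rw [h1, Pi.sub_apply, h2, h3, h4, Pi.smul_apply, h5, norm_smul, mul_comm]
  refine le_trans ?_ (mul_le_mul_of_nonneg_right (le_abs_self _) (norm_nonneg _))
  exact (convex_Icc (-τ) τ).norm_image_sub_le_of_norm_hasDerivWithin_le
    (f := fun t => frequencyFlow b t ζ)
    (fun x _ => (hasDerivAt_frequencyFlow b x ζ).hasDerivWithinAt)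
    (fun x hx => hMR x (abs_le.2 hx) ζ) (abs_le.1 ht) (abs_le.1 hs)

theorem hasDerivAt_integral_frequencyFlow {b : 𝓢(Phase d, ℂ)} (hb : HasCompactSupport b)
    (f : Lp ℂ 2 (volume : Measure (Phase d))) (t : ℝ) :
    HasDerivAt (fun s => ∫ ζ, f ζ * frequencyFlow b s ζ) (∫ ζ, f ζ * frequencyFlowDeriv b t ζ) t := by
  obtain ⟨M, R, hMR⟩ := exists_bound_frequencyFlowDeriv hb (|t| + 1)
  have hi : ∀ s, Integrable fun ζ => f ζ * frequencyFlow b s ζ := fun s =>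
    integrable_Lp_mul_schwartz f (frequencyFlowSchwartz hb s)
  have hm : AEStronglyMeasurable (fun ζ => f ζ * frequencyFlowDeriv b t ζ) volume := by
    have h := (continuous_frequencyFlowDeriv b).comp (Continuous.prodMk_right t)
    exact (Lp.aestronglyMeasurable f).mul h.aestronglyMeasurable
  have hbound : ∀ᵐ ζ : Phase d, ∀ s ∈ Metric.ball t 1, ‖f ζ * frequencyFlowDeriv b s ζ‖ ≤
      ‖f ζ‖ * (Metric.closedBall (0 : Phase d) R).indicator (fun _ => M) ζ := by
    refine Filter.Eventually.of_forall fun ζ s hs => ?_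
    rw [norm_mul]
    refine mul_le_mul_of_nonneg_left (hMR s ?_ ζ) (norm_nonneg _)
    have h1 : |s - t| < 1 := by simpa [Real.dist_eq] using hs
    have h2 := abs_add_le (s - t) t
    rw [sub_add_cancel] at h2
    linarith
  have hint : Integrable fun ζ : Phase d =>
      ‖f ζ‖ * (Metric.closedBall (0 : Phase d) R).indicator (fun _ => M) ζ :=
    MemLp.integrable_mul (Lp.memLp f).norm (memLp_indicator_closedBall M R)
  have hderiv : ∀ᵐ ζ : Phase d, ∀ s ∈ Metric.ball t 1,
      HasDerivAt (fun s => f ζ * frequencyFlow b s ζ) (f ζ * frequencyFlowDeriv b s ζ) s :=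
    Filter.Eventually.of_forall fun ζ s _ => (hasDerivAt_frequencyFlow b s ζ).const_mul _
  exact (hasDerivAt_integral_of_dominated_loc_of_deriv_le (Metric.ball_mem_nhds t one_pos)
    (Filter.Eventually.of_forall fun s => (hi s).1) (hi t) hm hbound hint hderiv).2

end FrequencyFlow

/-! ### A product rule for weakly differentiable factors. -/

section Duality

/-- Product rule for a bilinear pairing in which each factor is only weakly differentiable. -/
theorem hasDerivWithinAt_bilinear {X Y : Type*} [NormedAddCommGroup X] [NormedSpace ℂ X]
    [NormedAddCommGroup Y] [NormedSpace ℂ Y] (P : X →L[ℂ] Y →L[ℂ] ℂ) {G : ℝ → X} {B : ℝ → Y}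
    {S : Set ℝ} {t : ℝ} {D₁ D₂ : ℂ} (h₁ : HasDerivWithinAt (fun s => P (G s) (B t)) D₁ S t)
    (h₂ : HasDerivWithinAt (fun s => P (G t) (B s)) D₂ S t) (hG : ContinuousWithinAt G S t)
    {L : ℝ} (hB : ∀ᶠ s in nhdsWithin t S, ‖B s - B t‖ ≤ L * |s - t|) :
    HasDerivWithinAt (fun s => P (G s) (B s)) (D₁ + D₂) S t := by
  -- The cross term is `o(1) · O(s - t)`, by continuity of `G` and the Lipschitz bound on `B`.
  have h3 : HasDerivWithinAt (fun s => P (G s - G t) (B s - B t)) 0 S t := by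
    rw [hasDerivWithinAt_iff_isLittleO]
    simp only [sub_self, map_zero, sub_zero, smul_zero]
    have hG' : (fun s => G s - G t) =o[nhdsWithin t S] (fun _ => (1 : ℝ)) := by
      rw [Asymptotics.isLittleO_one_iff]
      simpa using hG.sub_const (G t)
    have hB' : (fun s => B s - B t) =O[nhdsWithin t S] (fun s => s - t) :=
      Asymptotics.IsBigO.of_bound L (by simpa only [Real.norm_eq_abs] using hB)
    have hP : (fun s => P (G s - G t) (B s - B t)) =O[nhdsWithin t S]
        (fun s => ‖G s - G t‖ * ‖B s - B t‖) := by
      refine Asymptotics.IsBigO.of_bound ‖P‖ (Filter.Eventually.of_forall fun s => ?_)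
      rw [norm_mul, norm_norm, norm_norm, ← mul_assoc]
      exact P.le_opNorm₂ _ _
    refine hP.trans_isLittleO ?_
    simpa using hG'.norm_left.mul_isBigO hB'.norm_left
  have e : (fun s => P (G s) (B s)) = fun s =>
      P (G s) (B t) + P (G t) (B s) + P (G s - G t) (B s - B t) - P (G t) (B t) := by
    funext s
    simp only [map_sub, _root_.sub_apply]
    ring
  rw [e, ← add_zero (D₁ + D₂)]
  exact ((h₁.add h₂).add h3).sub_const _

end Duality

/-! ### The Fourier representation of weak solutions. -/

section Representation

open SchwartzMap FourierTransform
open scoped ContDiff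

variable {d : ℕ} {g₀ : Lp ℂ 2 (volume : Measure (Phase d))}
  {g : ℝ → Lp ℂ 2 (volume : Measure (Phase d))}

theorem continuous_fourierLp {E : Type*} [NormedAddCommGroup E] [InnerProductSpace ℝ E]
    [FiniteDimensional ℝ E] [MeasurableSpace E] [BorelSpace E] :
    Continuous fun f : Lp ℂ 2 (volume : Measure E) => (𝓕 f : Lp ℂ 2 (volume : Measure E)) :=
  (Lp.fourierTransformₗᵢ E ℂ).continuous

theorem IsKolmogorovSolution.continuousOn_fourier (hg : IsKolmogorovSolution g₀ g) :
    ContinuousOn (fun s => (𝓕 (g s) : Lp ℂ 2 (volume : Measure (Phase d)))) (Set.Ici 0) :=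
  continuous_fourierLp.comp_continuousOn hg.continuousOn

theorem IsKolmogorovSolution.weak_fourier (hg : IsKolmogorovSolution g₀ g) (b : 𝓢(Phase d, ℂ))
    {t : ℝ} (ht : 0 ≤ t) :
    (∫ ζ, (𝓕 (g t) : Lp ℂ 2 (volume : Measure (Phase d))) ζ * b ζ) -
      (∫ ζ, (𝓕 g₀ : Lp ℂ 2 (volume : Measure (Phase d))) ζ * b ζ) =
      ∫ s in (0 : ℝ)..t,
        ∫ ζ, (𝓕 (g s) : Lp ℂ 2 (volume : Measure (Phase d))) ζ * frequencyGenerator b ζ := by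
  simp_rw [integral_fourier_mul_schwartz, ← kolmogorovSchwartz_fourier]
  exact hg.weak_schwartz (𝓕 b) ht

theorem IsKolmogorovSolution.hasDerivWithinAt_fourier (hg : IsKolmogorovSolution g₀ g)
    (b : 𝓢(Phase d, ℂ)) {t : ℝ} (ht : 0 ≤ t) :
    HasDerivWithinAt (fun s => ∫ ζ, (𝓕 (g s) : Lp ℂ 2 (volume : Measure (Phase d))) ζ * b ζ)
      (∫ ζ, (𝓕 (g t) : Lp ℂ 2 (volume : Measure (Phase d))) ζ * frequencyGenerator b ζ)
      (Set.Ici t) t := by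
  set ψ : ℝ → ℂ := fun s =>
    ∫ ζ, (𝓕 (g s) : Lp ℂ 2 (volume : Measure (Phase d))) ζ * frequencyGenerator b ζ with hψ
  have hψc : ContinuousOn ψ (Set.Ici 0) :=
    (continuous_integral_Lp_mul ((frequencyGenerator b).memLp 2 volume)).comp_continuousOn
      hg.continuousOn_fourier
  -- Freezing `ψ` at its value at `0` for negative times makes it continuous on the line, so the
  -- fundamental theorem of calculus also covers `t = 0`.
  have hc : Continuous fun s => ψ (max s 0) :=
    hψc.comp_continuous (by fun_prop) fun s => Set.mem_Ici.2 (le_max_right s 0)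
  have h1 : HasDerivAt (fun u => ∫ s in (0 : ℝ)..u, ψ (max s 0)) (ψ (max t 0)) t :=
    intervalIntegral.integral_hasDerivAt_right (hc.intervalIntegrable _ _)
      (hc.stronglyMeasurableAtFilter _ _) hc.continuousAt
  rw [max_eq_left ht] at h1
  have h2 := (h1.const_add
    (∫ ζ, (𝓕 g₀ : Lp ℂ 2 (volume : Measure (Phase d))) ζ * b ζ)).hasDerivWithinAt (s := Set.Ici t)
  have e : ∀ u, t ≤ u → (∫ ζ, (𝓕 (g u) : Lp ℂ 2 (volume : Measure (Phase d))) ζ * b ζ) =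
      (∫ ζ, (𝓕 g₀ : Lp ℂ 2 (volume : Measure (Phase d))) ζ * b ζ) +
        ∫ s in (0 : ℝ)..u, ψ (max s 0) := by
    intro u hu
    rw [← sub_eq_iff_eq_add', hg.weak_fourier b (ht.trans hu)]
    refine intervalIntegral.integral_congr fun s hs => ?_
    rw [Set.uIcc_of_le (ht.trans hu)] at hs
    simp only [max_eq_left hs.1, hψ]
  exact h2.congr (fun u hu => e u hu) (e t le_rfl)

/-- The pairing of `𝓕 (g s)` with the flow has zero right derivative, hence is constant on `[0, T]`;
at `s = 0` the flow is `b`. -/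
theorem IsKolmogorovSolution.integral_fourier_mul_frequencyFlow (hg : IsKolmogorovSolution g₀ g)
    {b : 𝓢(Phase d, ℂ)} (hb : HasCompactSupport b) {T : ℝ} (hT : 0 ≤ T) :
    ∫ ζ, (𝓕 (g T) : Lp ℂ 2 (volume : Measure (Phase d))) ζ * frequencyFlow b T ζ =
      ∫ ζ, (𝓕 g₀ : Lp ℂ 2 (volume : Measure (Phase d))) ζ * b ζ := by
  obtain ⟨L, hL⟩ := exists_lipschitz_frequencyFlow hb (T + 1)
  set G : ℝ → Lp ℂ 2 (volume : Measure (Phase d)) := fun s => 𝓕 (g s) with hG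
  set B : ℝ → Lp ℂ 2 (volume : Measure (Phase d)) :=
    fun s => (frequencyFlowSchwartz hb s).toLp 2 volume with hB
  have hGc : ContinuousOn G (Set.Ici 0) := hg.continuousOn_fourier
  have hP : ∀ (f : Lp ℂ 2 (volume : Measure (Phase d))) s,
      pairingLp volume f (B s) = ∫ ζ, f ζ * frequencyFlow b s ζ := fun f s =>
    pairingLp_toLp f ((frequencyFlowSchwartz hb s).memLp 2 volume)
  have hBL : ∀ t, 0 ≤ t → t ≤ T → ∀ᶠ s in nhds t, ‖B s - B t‖ ≤ L * |s - t| := by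
    intro t ht0 htT
    filter_upwards [Metric.ball_mem_nhds t one_pos] with s hs
    have h1 : |s - t| < 1 := by simpa [Real.dist_eq] using hs
    have h2 := abs_lt.1 h1
    exact hL s t (abs_le.2 ⟨by linarith, by linarith⟩) (abs_le.2 ⟨by linarith, by linarith⟩)
  have hBc : ∀ t, 0 ≤ t → t ≤ T → ContinuousAt B t := by
    intro t ht0 htT
    rw [ContinuousAt, tendsto_iff_norm_sub_tendsto_zero]
    have h0 : Filter.Tendsto (fun s => L * |s - t|) (nhds t) (nhds 0) := by
      have : Continuous fun s => L * |s - t| := by fun_prop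
      simpa using this.tendsto t
    exact squeeze_zero' (Filter.Eventually.of_forall fun s => norm_nonneg _) (hBL t ht0 htT) h0
  have hconst := constant_of_has_deriv_right_zero (f := fun s => pairingLp volume (G s) (B s))
    (a := 0) (b := T) ?_ ?_ T ⟨hT, le_rfl⟩
  · simp only [hP] at hconst
    rw [hG] at hconst
    simp only at hconst
    rw [hconst, hg.initial]
    congr 1 with ζ
    simp [frequencyFlow, shear_zero, dissipation]
  · intro t ht
    have h1 : ContinuousWithinAt G (Set.Icc 0 T) t :=
      (hGc t ht.1).mono Set.Icc_subset_Ici_self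
    have h2 := (hBc t ht.1 ht.2).continuousWithinAt (s := Set.Icc 0 T)
    exact ((pairingLp volume).continuous.continuousAt.comp_continuousWithinAt h1).clm_apply h2
  · intro t ht
    have h1 : HasDerivWithinAt (fun s => pairingLp volume (G s) (B t))
        (∫ ζ, G t ζ * frequencyGenerator (frequencyFlowSchwartz hb t) ζ) (Set.Ici t) t := by
      simp only [hP]
      exact hg.hasDerivWithinAt_fourier (frequencyFlowSchwartz hb t) ht.1
    have h2 : HasDerivWithinAt (fun s => pairingLp volume (G t) (B s))
        (∫ ζ, G t ζ * frequencyFlowDeriv b t ζ) (Set.Ici t) t := by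
      simp only [hP]
      exact (hasDerivAt_integral_frequencyFlow hb (G t) t).hasDerivWithinAt
    have h3 := hasDerivWithinAt_bilinear (pairingLp volume) h1 h2
      ((hGc t ht.1).mono (Set.Ici_subset_Ici.2 ht.1))
      ((hBL t ht.1 ht.2.le).filter_mono nhdsWithin_le_nhds)
    refine h3.congr_deriv ?_
    simp only [frequencyGenerator_frequencyFlow, mul_neg, integral_neg]
    exact neg_add_cancel _

/-- The explicit Fourier representation of weak solutions of the Kolmogorov equation. -/
theorem IsKolmogorovSolution.fourier_eq (hg : IsKolmogorovSolution g₀ g) {T : ℝ} (hT : 0 ≤ T) :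
    (𝓕 (g T) : Lp ℂ 2 (volume : Measure (Phase d))) =ᵐ[volume] fun ζ =>
      (𝓕 g₀ : Lp ℂ 2 (volume : Measure (Phase d))) (shear T ζ) *
        (Real.exp (-(4 * Real.pi ^ 2 * dissipation T ζ)) : ℂ) := by
  have hsh := measurePreserving_shear (d := d) T
  have hmeas : AEStronglyMeasurable (fun ζ : Phase d =>
      (Real.exp (-(4 * Real.pi ^ 2 * dissipation T ζ)) : ℂ)) volume := by
    refine Continuous.aestronglyMeasurable ?_
    have : Continuous fun ζ : Phase d => dissipation T ζ :=
      continuous_dissipation.comp (by fun_prop : Continuous fun ζ : Phase d => (T, ζ))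
    fun_prop
  refine ae_eq_of_integral_mul_schwartz_eq (locallyIntegrable_Lp _) ?_ fun c hc => ?_
  · refine MemLp.locallyIntegrable (p := 2) ?_ (by norm_num)
    have h1 : MemLp (fun ζ => (𝓕 g₀ : Lp ℂ 2 (volume : Measure (Phase d))) (shear T ζ)) 2 volume :=
      (Lp.memLp _).comp_measurePreserving hsh
    refine h1.of_le (h1.1.mul hmeas) (Filter.Eventually.of_forall fun ζ => ?_)
    rw [norm_mul, Complex.norm_real, Real.norm_of_nonneg (Real.exp_nonneg _)]
    refine mul_le_of_le_one_right (norm_nonneg _) (Real.exp_le_one_iff.2 ?_)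
    have := dissipation_nonneg hT ζ
    have : 0 ≤ 4 * Real.pi ^ 2 * dissipation T ζ := by positivity
    linarith
  -- The datum is chosen by running the flow backwards, so that at time `T` it becomes the given
  -- test function `c`.
  · let b₀ : Phase d → ℂ := fun ζ => c (shear (-T) ζ) *
      (Real.exp (-(4 * Real.pi ^ 2 * dissipation T (shear (-T) ζ))) : ℂ)
    have hb₀ : ∀ ζ, b₀ (shear T ζ) =
        c ζ * (Real.exp (-(4 * Real.pi ^ 2 * dissipation T ζ)) : ℂ) := fun ζ => by
      simp only [b₀, shear_shear, neg_add_cancel, shear_zero]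
    have hsupp : HasCompactSupport b₀ := by
      obtain ⟨R, hR⟩ := exists_radius_of_hasCompactSupport hc |(-T)|
      refine HasCompactSupport.intro (isCompact_closedBall (0 : Phase d) R) fun ζ hζ => ?_
      simp only [b₀]
      rw [(hR (-T) le_rfl ζ hζ).1, zero_mul]
    have hsmooth : ContDiff ℝ ∞ b₀ := by
      have h : ContDiff ℝ ∞ (dissipation T : Phase d → ℝ) := by
        unfold dissipation
        fun_prop
      exact ((c.smooth ⊤).comp (shear (-T)).contDiff).mul (Complex.ofRealCLM.contDiff.comp
        (Real.contDiff_exp.comp ((contDiff_const.mul (h.comp (shear (-T)).contDiff)).neg)))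
    let b : 𝓢(Phase d, ℂ) := hsupp.toSchwartzMap hsmooth
    have hb : ∀ ζ, b ζ = b₀ ζ := fun _ => rfl
    have hflow : ∀ ζ, frequencyFlow b T ζ = c ζ := fun ζ => by
      rw [frequencyFlow, hb, hb₀, mul_assoc, ← Complex.ofReal_mul, ← Real.exp_add, neg_add_cancel,
        Real.exp_zero, Complex.ofReal_one, mul_one]
    have h := hg.integral_fourier_mul_frequencyFlow (b := b) hsupp hT
    simp only [hflow] at h
    have hm : AEStronglyMeasurable (fun ζ =>
        (𝓕 g₀ : Lp ℂ 2 (volume : Measure (Phase d))) ζ * b ζ)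
        (volume.map (shear T : Phase d → Phase d)) := by
      rw [hsh.map_eq]
      exact (integrable_Lp_mul_schwartz _ b).1
    have hcv := integral_map hsh.measurable.aemeasurable hm
    rw [hsh.map_eq] at hcv
    rw [h, hcv]
    refine integral_congr_ae (Filter.Eventually.of_forall fun ζ => ?_)
    simp only [hb, hb₀]
    ring

end Representation

/-! ### Scalar interpolation inequalities. -/

section Interpolation

theorem rpow_le_add_rpow_sub_one_mul {α Λ y : ℝ} (hα : 0 ≤ α) (hα1 : α ≤ 1) (hΛ : 0 < Λ)
    (hy : 0 < y) : y ^ α ≤ Λ ^ α + Λ ^ (α - 1) * y := by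
  rcases le_total y Λ with h | h
  · exact (Real.rpow_le_rpow hy.le h hα).trans (le_add_of_nonneg_right (by positivity))
  · have h1 : y ^ α = y ^ (α - 1) * y := by rw [Real.rpow_sub_one hy.ne', div_mul_cancel₀ _ hy.ne']
    rw [h1]
    refine le_trans ?_ (le_add_of_nonneg_left (by positivity))
    exact mul_le_mul_of_nonneg_right
      (Real.rpow_le_rpow_of_nonpos hΛ h (by linarith)) hy.le

/-- Young's inequality `R x ≤ R²/(4ατ) + ατx²` produces the power `α` of the Gaussian, which is then
split at the level `Λ`. The cost `1/(ατ)` of the final estimate arises here. -/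
theorem exp_mul_le_of_gaussian {R τ α Λ x : ℝ} (hτ : 0 < τ) (hα : 0 < α) (hα1 : α ≤ 1)
    (hΛ : 0 < Λ) : Real.exp (R * x) ≤ Real.exp (R ^ 2 / (4 * α * τ)) *
      (Λ ^ α + Λ ^ (α - 1) * Real.exp (τ * x ^ 2)) := by
  have h1 : R * x ≤ R ^ 2 / (4 * α * τ) + τ * x ^ 2 * α := by
    have h : 0 ≤ (R - 2 * α * τ * x) ^ 2 / (4 * α * τ) := by positivity
    have e : (R - 2 * α * τ * x) ^ 2 / (4 * α * τ) =
        R ^ 2 / (4 * α * τ) + τ * x ^ 2 * α - R * x := by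
      field_simp
      ring
    linarith
  calc Real.exp (R * x) ≤ Real.exp (R ^ 2 / (4 * α * τ) + τ * x ^ 2 * α) := Real.exp_le_exp.2 h1
    _ = Real.exp (R ^ 2 / (4 * α * τ)) * Real.exp (τ * x ^ 2) ^ α := by
        rw [Real.exp_add, Real.exp_mul]
    _ ≤ _ := by
        gcongr
        exact rpow_le_add_rpow_sub_one_mul hα.le hα1 hΛ (Real.exp_pos _)

/-- Write `f = f^(1-α) f^α` and use the hypothesis in the first factor only. As `K` and `(m/f)^α`
are at least `1`, their powers `1 - α` are simply enlarged, so no constant degenerates as `α → 1`.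
-/
theorem le_mul_rpow_of_le_mul_div_rpow {α K f m a : ℝ} (hα : 0 ≤ α) (hα1 : α ≤ 1) (hK : 1 ≤ K)
    (hf : 0 < f) (hfm : f ≤ m) (ha : 0 ≤ a) (h : f ≤ K * (m / f) ^ α * a) :
    f ≤ K * a ^ (1 - α) * m ^ α := by
  have hm : 0 < m := hf.trans_le hfm
  have hq : 1 ≤ m / f := (one_le_div hf).2 hfm
  have hq0 : 0 < m / f := by positivity
  have hK0 : 0 < K := by linarith
  calc f = f ^ (1 - α) * f ^ α := by rw [← Real.rpow_add hf]; simp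
    _ ≤ (K * (m / f) ^ α * a) ^ (1 - α) * f ^ α := by gcongr
    _ = K ^ (1 - α) * ((m / f) ^ α) ^ (1 - α) * a ^ (1 - α) * f ^ α := by
        rw [Real.mul_rpow (by positivity) ha, Real.mul_rpow hK0.le (by positivity)]
    _ ≤ K * (m / f) ^ α * a ^ (1 - α) * f ^ α := by
        have h1 : K ^ (1 - α) ≤ K := by
          simpa using Real.rpow_le_rpow_of_exponent_le hK (by linarith : 1 - α ≤ 1)
        have h2 : ((m / f) ^ α) ^ (1 - α) ≤ (m / f) ^ α := by
          simpa using Real.rpow_le_rpow_of_exponent_le (Real.one_le_rpow hq hα)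
            (by linarith : 1 - α ≤ 1)
        gcongr
    _ = K * a ^ (1 - α) * m ^ α := by
        rw [Real.div_rpow hm.le hf.le]
        field_simp

/-- Optimizing over `n` an inequality `f ≤ C (Aⁿ a + A⁻ⁿ Z f)`. -/
theorem le_of_forall_pow_le {C A Z f a : ℝ} (hC : 0 < C) (hA : 1 < A) (hZ : 1 ≤ Z) (hf : 0 ≤ f)
    (ha : 0 ≤ a) (h : ∀ n : ℕ, 0 < n → f ≤ C * (A ^ n * a + (A ^ n)⁻¹ * (Z * f))) :
    f ≤ 2 * C * A * (2 * C + 1) * Z * a := by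
  -- The inequality is used at `n + 1`, which is positive: `A ^ (n + 1)` exceeds `2CZ`, so the error
  -- is at most `f / 2`, yet it is at most `A (2C + 1) Z`.
  obtain ⟨n, hn1, hn2⟩ := exists_nat_pow_near (x := (2 * C + 1) * Z) (by nlinarith) hA
  have hA0 : 0 < A := by linarith
  have h1 := h (n + 1) n.succ_pos
  have h2 : C * ((A ^ (n + 1))⁻¹ * (Z * f)) ≤ f / 2 := by
    have h3 : C * ((A ^ (n + 1))⁻¹ * (Z * f)) = C * Z * f / A ^ (n + 1) := by
      field_simp
    rw [h3, div_le_div_iff₀ (by positivity) two_pos]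
    have h4 : 2 * C * Z ≤ A ^ (n + 1) := by nlinarith
    nlinarith
  have h5 : A ^ (n + 1) * a ≤ A * ((2 * C + 1) * Z) * a := by
    rw [pow_succ']
    gcongr
  have h6 : C * (A ^ (n + 1) * a) ≤ C * (A * ((2 * C + 1) * Z) * a) := by gcongr
  nlinarith

theorem inv_min_le {T : ℝ} (hT : 0 < T) : (min T (T ^ 3))⁻¹ ≤ 1 + 1 / T ^ 3 := by
  have h3 : 0 < T ^ 3 := by positivity
  rcases min_choice T (T ^ 3) with h | h
  · have h1 : T ≤ T ^ 3 := min_eq_left_iff.1 h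
    have h2 : 1 ≤ T := by
      by_contra hlt
      push Not at hlt
      nlinarith [mul_pos hT hT]
    rw [h]
    have : T⁻¹ ≤ 1 := inv_le_one_of_one_le₀ h2
    have : 0 < 1 / T ^ 3 := by positivity
    linarith
  · rw [h, one_div]
    linarith

end Interpolation

/-! ### Smoothing and weighted norms of solutions. -/

section Observability

open FourierTransform
open scoped ENNReal

variable {d : ℕ} {g₀ : Lp ℂ 2 (volume : Measure (Phase d))}
  {g : ℝ → Lp ℂ 2 (volume : Measure (Phase d))}

/-- Gaussian smoothing: the Fourier transform of the solution gains the weight `exp (τ |ζ|²)`. -/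
theorem IsKolmogorovSolution.norm_fourier_le (hg : IsKolmogorovSolution g₀ g) {T : ℝ}
    (hT : 0 < T) : ∀ᵐ ζ : Phase d,
      Real.exp (min T (T ^ 3) * ‖ζ‖ ^ 2) *
        ‖(𝓕 (g T) : Lp ℂ 2 (volume : Measure (Phase d))) ζ‖ ≤
      ‖(𝓕 g₀ : Lp ℂ 2 (volume : Measure (Phase d))) (shear T ζ)‖ := by
  filter_upwards [hg.fourier_eq hT.le] with ζ hζ
  rw [hζ, norm_mul, Complex.norm_real, Real.norm_of_nonneg (Real.exp_nonneg _), mul_left_comm,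
    ← Real.exp_add]
  refine mul_le_of_le_one_right (norm_nonneg _) (Real.exp_le_one_iff.2 ?_)
  have h1 := le_dissipation hT ζ
  have h2 : 0 ≤ min T (T ^ 3) * ‖ζ‖ ^ 2 := by positivity
  have h3 : 0 ≤ dissipation T ζ := dissipation_nonneg hT.le ζ
  -- Since `4π² > 36`, the factor `1/21` in the lower bound for the dissipation is compensated.
  have h4 : 21 * dissipation T ζ ≤ 4 * Real.pi ^ 2 * dissipation T ζ := by
    gcongr
    nlinarith [Real.pi_gt_three]
  linarith

theorem eLpNorm_fourier_comp_shear (f : Lp ℂ 2 (volume : Measure (Phase d))) (T : ℝ) :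
    eLpNorm (fun ζ => (𝓕 f : Lp ℂ 2 (volume : Measure (Phase d))) (shear T ζ)) 2 volume =
      ENNReal.ofReal ‖f‖ := by
  have h := eLpNorm_comp_measurePreserving (p := 2)
    (Lp.aestronglyMeasurable (𝓕 f : Lp ℂ 2 (volume : Measure (Phase d))))
    (measurePreserving_shear (d := d) T)
  rw [← Lp.norm_fourier_eq f, ofReal_norm, Lp.enorm_def, ← h]
  rfl

theorem IsKolmogorovSolution.norm_le (hg : IsKolmogorovSolution g₀ g) {T : ℝ} (hT : 0 < T) :
    ‖g T‖ ≤ ‖g₀‖ := by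
  have h : ENNReal.ofReal ‖g T‖ ≤ ENNReal.ofReal ‖g₀‖ := by
    rw [← eLpNorm_fourier_comp_shear g₀ T, ← Lp.norm_fourier_eq (g T), ofReal_norm, Lp.enorm_def]
    refine eLpNorm_mono_ae ?_
    filter_upwards [hg.norm_fourier_le hT] with ζ hζ
    refine le_trans (le_mul_of_one_le_left (norm_nonneg _) (Real.one_le_exp ?_)) hζ
    positivity
  exact (ENNReal.ofReal_le_ofReal_iff (norm_nonneg _)).1 h

/-- The exponentially weighted Fourier transform of the solution interpolates between `g T` and
the initial datum. -/
theorem IsKolmogorovSolution.eLpNorm_exp_fourier_le (hg : IsKolmogorovSolution g₀ g) {T R α Λ : ℝ}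
    (hT : 0 < T) (hα : 0 < α) (hα1 : α ≤ 1) (hΛ : 0 < Λ) :
    eLpNorm (fun ζ => Real.exp (R * ‖ζ‖) •
        (𝓕 (g T) : Lp ℂ 2 (volume : Measure (Phase d))) ζ) 2 volume ≤
      ENNReal.ofReal (Real.exp (R ^ 2 / (4 * α * min T (T ^ 3))) *
        (Λ ^ α * ‖g T‖ + Λ ^ (α - 1) * ‖g₀‖)) := by
  have hτ : 0 < min T (T ^ 3) := lt_min hT (by positivity)
  set E := Real.exp (R ^ 2 / (4 * α * min T (T ^ 3))) with hE
  set F : Phase d → ℂ := ⇑(𝓕 (g T) : Lp ℂ 2 (volume : Measure (Phase d))) with hF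
  set H : Phase d → ℂ :=
    fun ζ => (𝓕 g₀ : Lp ℂ 2 (volume : Measure (Phase d))) (shear T ζ) with hH
  have hFm : AEStronglyMeasurable F volume := Lp.aestronglyMeasurable _
  have hHm : AEStronglyMeasurable H volume :=
    (Lp.aestronglyMeasurable _).comp_measurePreserving (measurePreserving_shear T)
  have hFn : eLpNorm F 2 volume = ENNReal.ofReal ‖g T‖ := by
    rw [← Lp.norm_fourier_eq (g T), ofReal_norm, Lp.enorm_def]
  have h1 : eLpNorm (fun ζ => Real.exp (R * ‖ζ‖) • F ζ) 2 volume ≤ ENNReal.ofReal E *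
      eLpNorm ((fun ζ => Λ ^ α * ‖F ζ‖) + fun ζ => Λ ^ (α - 1) * ‖H ζ‖) 2 volume := by
    refine eLpNorm_le_mul_eLpNorm_of_ae_le_mul ?_ 2
    filter_upwards [hg.norm_fourier_le hT] with ζ hζ
    rw [norm_smul, Real.norm_of_nonneg (Real.exp_nonneg _), Pi.add_apply,
      Real.norm_of_nonneg (by positivity)]
    calc Real.exp (R * ‖ζ‖) * ‖F ζ‖
        ≤ E * (Λ ^ α + Λ ^ (α - 1) * Real.exp (min T (T ^ 3) * ‖ζ‖ ^ 2)) * ‖F ζ‖ := by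
          gcongr
          exact exp_mul_le_of_gaussian hτ hα hα1 hΛ
      _ = E * (Λ ^ α * ‖F ζ‖ +
            Λ ^ (α - 1) * (Real.exp (min T (T ^ 3) * ‖ζ‖ ^ 2) * ‖F ζ‖)) := by ring
      _ ≤ E * (Λ ^ α * ‖F ζ‖ + Λ ^ (α - 1) * ‖H ζ‖) := by gcongr
  refine h1.trans ?_
  rw [ENNReal.ofReal_mul (Real.exp_nonneg _)]
  gcongr
  refine (eLpNorm_add_le (hFm.norm.const_mul _) (hHm.norm.const_mul _) (by norm_num)).trans ?_
  rw [ENNReal.ofReal_add (by positivity) (by positivity), ENNReal.ofReal_mul (by positivity),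
    ENNReal.ofReal_mul (by positivity), ← hFn, ← eLpNorm_fourier_comp_shear g₀ T]
  have hs : ∀ (c : ℝ) (u : Phase d → ℂ), 0 ≤ c → eLpNorm (fun ζ => c * ‖u ζ‖) 2 volume =
      ENNReal.ofReal c * eLpNorm u 2 volume := by
    intro c u hc
    have := eLpNorm_const_smul c (fun ζ => ‖u ζ‖) 2 (volume : Measure (Phase d))
    rw [eLpNorm_norm, ← ofReal_norm, Real.norm_of_nonneg hc] at this
    exact this
  rw [hs _ F (by positivity), hs _ H (by positivity)]

end Observability

/-! ### The observability estimate. -/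

theorem theorem1 (d : ℕ) (hd : 0 < d) (ω : Set (Phase d)) (hω : IsObservabilityOpen ω) :
    ∃ C : ℝ, 0 < C ∧ ∀ (T : ℝ), 0 < T → ∀ (α : ℝ), 0 < α → α < 1 →
      ∀ (g₀ : Lp ℂ 2 (volume : Measure (Phase d)))
        (g : ℝ → Lp ℂ 2 (volume : Measure (Phase d))), IsKolmogorovSolution g₀ g →
        ‖g T‖ ≤ Real.exp (C / α * (1 + 1 / T ^ 3)) * normOn ω (g T) ^ (1 - α) * ‖g₀‖ ^ α := by
  obtain ⟨C, A, R, hC, hA, hR, hspec⟩ := hω.exists_spectral_inequality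
  -- The last factor `2` comes from `Z = 2 E (‖g₀‖/‖g T‖)^α`; the maximum with `1` makes `log D`
  -- nonnegative, so that it may be enlarged to `log D / α`.
  set D : ℝ := max 1 (2 * C * A * (2 * C + 1) * 2) with hD
  have hD1 : 1 ≤ D := le_max_left _ _
  have hlog : 0 ≤ Real.log D := Real.log_nonneg hD1
  refine ⟨R ^ 2 / 4 + Real.log D, by positivity, fun T hT α hα hα1 g₀ g hg => ?_⟩
  have hτ : 0 < min T (T ^ 3) := lt_min hT (by positivity)
  set a : ℝ := normOn ω (g T) with ha
  have ha0 : 0 ≤ a := ENNReal.toReal_nonneg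
  rcases (norm_nonneg (g T)).eq_or_lt with h0 | hpos
  · rw [← h0]
    positivity
  have hle : ‖g T‖ ≤ ‖g₀‖ := hg.norm_le hT
  have hq : 1 ≤ ‖g₀‖ / ‖g T‖ := (one_le_div hpos).2 hle
  have hq0 : 0 < ‖g₀‖ / ‖g T‖ := by positivity
  set E := Real.exp (R ^ 2 / (4 * α * min T (T ^ 3))) with hE
  have hE1 : 1 ≤ E := Real.one_le_exp (by positivity)
  have hΛ1 : 1 ≤ (‖g₀‖ / ‖g T‖) ^ α := Real.one_le_rpow hq hα.le
  have hZ : 1 ≤ 2 * E * (‖g₀‖ / ‖g T‖) ^ α := by nlinarith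
  have hbound : ∀ n : ℕ, 0 < n → ‖g T‖ ≤
      C * (A ^ n * a + (A ^ n)⁻¹ * (2 * E * (‖g₀‖ / ‖g T‖) ^ α * ‖g T‖)) := by
    intro n hn
    have hA0 : 0 < A := by linarith
    have h1 := hspec (g T) n hn
    -- The splitting level `Λ = ‖g₀‖/‖g T‖` makes the two terms of the bound equal, as `h3` records.
    have h2 := hg.eLpNorm_exp_fourier_le (R := R) hT hα hα1.le hq0
    have h3 : (‖g₀‖ / ‖g T‖) ^ α * ‖g T‖ + (‖g₀‖ / ‖g T‖) ^ (α - 1) * ‖g₀‖ =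
        2 * (‖g₀‖ / ‖g T‖) ^ α * ‖g T‖ := by
      have : ‖g₀‖ ≠ 0 := (hpos.trans_le hle).ne'
      rw [Real.rpow_sub_one hq0.ne']
      field_simp
      ring
    rw [h3] at h2
    have h4 : eLpNorm (g T) 2 (volume.restrict ω) = ENNReal.ofReal a :=
      (ENNReal.ofReal_toReal (((Lp.memLp (g T)).restrict ω).eLpNorm_ne_top)).symm
    have h5 : ENNReal.ofReal ‖g T‖ ≤ ENNReal.ofReal
        (C * (A ^ n * a + (A ^ n)⁻¹ * (2 * E * (‖g₀‖ / ‖g T‖) ^ α * ‖g T‖))) := by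
      rw [ofReal_norm, Lp.enorm_def]
      refine h1.trans ?_
      rw [ENNReal.ofReal_mul hC.le, ENNReal.ofReal_add (by positivity) (by positivity),
        ENNReal.ofReal_mul (by positivity), h4, ENNReal.ofReal_mul (by positivity)]
      gcongr
      refine h2.trans (le_of_eq ?_)
      congr 1
      ring
    exact (ENNReal.ofReal_le_ofReal_iff (by positivity)).1 h5
  have h1 := le_of_forall_pow_le hC hA hZ hpos.le ha0 hbound
  have h2 : ‖g T‖ ≤ D * E * (‖g₀‖ / ‖g T‖) ^ α * a := by
    refine h1.trans ?_
    have : 2 * C * A * (2 * C + 1) * 2 ≤ D := le_max_right _ _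
    calc 2 * C * A * (2 * C + 1) * (2 * E * (‖g₀‖ / ‖g T‖) ^ α) * a
        = 2 * C * A * (2 * C + 1) * 2 * E * (‖g₀‖ / ‖g T‖) ^ α * a := by ring
      _ ≤ _ := by gcongr
  refine (le_mul_rpow_of_le_mul_div_rpow hα.le hα1.le (one_le_mul_of_one_le_of_one_le hD1 hE1)
    hpos hle ha0 h2).trans ?_
  gcongr
  have hT3 : 0 < 1 / T ^ 3 := by positivity
  have hDE : D * E = Real.exp (Real.log D + R ^ 2 / (4 * α * min T (T ^ 3))) := by
    rw [Real.exp_add, Real.exp_log (by linarith)]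
  rw [hDE, Real.exp_le_exp, add_div, add_mul, add_comm]
  refine add_le_add ?_ ?_
  · have e : R ^ 2 / (4 * α * min T (T ^ 3)) = R ^ 2 / 4 / α * (min T (T ^ 3))⁻¹ := by
      field_simp
    rw [e]
    gcongr
    exact inv_min_le hT
  · have h3 : Real.log D ≤ Real.log D / α := by
      rw [le_div_iff₀ hα]
      exact mul_le_of_le_one_right hlog hα1.le
    exact h3.trans (le_mul_of_one_le_right (by positivity) (by linarith))
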